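/- Let $d\ge 1$ and let $\nu:\mathbb{R}^d\setminus\{0\}\to(0,\infty)$ be a Borel function with $\nu(-z)=\nu(z)$ and $\int_{\mathbb{R}^d}(|z|^2\wedge 1)\,\nu(z)\,dz<\infty$. Put $$\psi(\xi)=\int_{\mathbb{R}^d}\bigl(1-\cos(\xi\cdot x)\bigr)\nu(x)\,dx,\quad \xi\in\mathbb{R}^d,$$ and assume the Hartman–Wintner condition $\lim_{|\xi|\to\infty}\psi(\xi)/\log|\xi|=\infty$. For $t>0$ let $$p_t(x)=(2\pi)^{-d}\int_{\mathbb{R}^d}e^{-i\xi\cdot x}e^{-t\psi(\xi)}\,d\xi,\quad p_t(x,y)=p_t(y-x),\quad \nu(x,y)=\nu(y-x),$$ and assume that (P1) there is a constant $c$ such that $p_t(x,y)/t\le c\,\nu(x,y)$ for all $t>0$ and all $x\ne y$ in $\mathbb{R}^d$; (P2) $p_t(x,y)/t\to\nu(x,y)$ as $t\to0^+$, for all $x\neq y$ in $\mathbb{R}^d$. Let $P_tf(x)=\int_{\mathbb{R}^d}f(y)\,p_t(x,y)\,dy$ for $t>0$ and $P_0f=f$. For $a,\kappa\in\mathbb{R}$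 let $a^{\langle\kappa\rangle}=|a|^{\kappa}\,\mathrm{sgn}\,a$, with $0^{\langle\kappa\rangle}=0$. For $p\ge2$ and $w=(w_1,w_2),\ z=(z_1,z_2)\in\mathbb{R}^2$ define the Bregman co-divergence $$\mathcal{J}_p(w,z)=z_1z_2^{\langle p-1\rangle}-w_1w_2^{\langle p-1\rangle}-w_2^{\langle p-1\rangle}(z_1-w_1)-(p-1)\,w_1|w_2|^{p-2}(z_2-w_2),$$ with $0^0=1$. **Theorem 4.1** (Polarized Hardy–Stein identity). Let $p\ge2$ and $f,g\in L^p(\mathbb{R}^d)$ (real-valued). Denote $\Phi(x)=(f(x),g(x))$ and $P_t\Phi(x)=(P_tf(x),P_tg(x))$. Then $(t,x,y)\mapsto\mathcal{J}_p(P_t\Phi(x),P_t\Phi(y))\,\nu(x,y)$ is absolutely integrable on $(0,\infty)\times\mathbb{R}^d\times\mathbb{R}^d$, that is, $$\int_0^\infty\int_{\mathbb{R}^d}\int_{\mathbb{R}^d}\left|\mathcal{J}_p(P_t\Phi(x),P_t\Phi(y))\right|\nu(x,y)\,dx\,dy\,dt<\infty,$$ the function $f g^{\langle p-1\rangle}$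 is integrable, and $$\int_{\mathbb{R}^d}f\,g^{\langle p-1\rangle}\,dx=\int_0^\infty\int_{\mathbb{R}^d}\int_{\mathbb{R}^d}\mathcal{J}_p(P_t\Phi(x),P_t\Phi(y))\,\nu(x,y)\,dx\,dy\,dt.$$ -/

import Mathlib

open MeasureTheory Filter Topology Set

noncomputable section

namespace HardyStein

/-- Euclidean space `ℝ^d` with the Euclidean norm and Lebesgue measure. -/
abbrev Rd (d : ℕ) : Type := EuclideanSpace ℝ (Fin d)

/-- `ν` is (a Borel version of) the density of a symmetric, absolutely continuous Lévy measure on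
`ℝ^d`, strictly positive and finite off the origin. The value `ν 0` plays no role. -/
structure IsLevyDensity {d : ℕ} (ν : Rd d → ℝ) : Prop where
  measurable : Measurable ν
  pos : ∀ z, z ≠ 0 → 0 < ν z
  symm : ∀ z, z ≠ 0 → ν (-z) = ν z
  integrable : Integrable (fun z => min (‖z‖ ^ 2) 1 * ν z)

/-- The Lévy–Khinchine exponent `ψ(ξ) = ∫ (1 - cos (ξ · x)) ν(x) dx`. -/
def levyExponent {d : ℕ} (ν : Rd d → ℝ) (ξ : Rd d) : ℝ :=
  ∫ x, (1 - Real.cos (inner ℝ ξ x)) * ν x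

/-- The Hartman–Wintner condition: `ψ(ξ) / log |ξ| → ∞` as `|ξ| → ∞`. -/
def HartmanWintner {d : ℕ} (ν : Rd d → ℝ) : Prop :=
  Tendsto (fun ξ : Rd d => levyExponent ν ξ / Real.log ‖ξ‖) (Bornology.cobounded (Rd d)) atTop

/-- The convolution density `p_t(x) = (2π)^{-d} ∫ e^{-i ξ·x} e^{-t ψ(ξ)} dξ`. The integral is real
because `ψ` is even; `re` only changes the type. -/
def heatDensity {d : ℕ} (ν : Rd d → ℝ) (t : ℝ) (x : Rd d) : ℝ :=
  ((2 * Real.pi) ^ d)⁻¹ *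
    (∫ ξ : Rd d, Complex.exp (-Complex.I * ((inner ℝ ξ x : ℝ) : ℂ)) *
      Complex.exp (-((t * levyExponent ν ξ : ℝ) : ℂ))).re

/-- The transition density `p_t(x, y) = p_t(y - x)`. -/
def heatKernel {d : ℕ} (ν : Rd d → ℝ) (t : ℝ) (x y : Rd d) : ℝ :=
  heatDensity ν t (y - x)

/-- The jump kernel `ν(x, y) = ν(y - x)`. -/
def jumpKernel {d : ℕ} (ν : Rd d → ℝ) (x y : Rd d) : ℝ :=
  ν (y - x)

/-- `p_t(x, y) / t ≤ c ν(x, y)` with a constant `c`, for all `t > 0` and `x, y` off the diagonal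
(where `ν(x, y)` is defined). -/
def RelativeUpperBound {d : ℕ} (ν : Rd d → ℝ) : Prop :=
  ∃ c : ℝ, ∀ t : ℝ, 0 < t → ∀ x y : Rd d, x ≠ y → heatKernel ν t x y / t ≤ c * jumpKernel ν x y

/-- `p_t(x, y) / t → ν(x, y)` as `t → 0⁺`, for all `x, y` off the diagonal. -/
def SmallTimeLimit {d : ℕ} (ν : Rd d → ℝ) : Prop :=
  ∀ x y : Rd d, x ≠ y →
    Tendsto (fun t : ℝ => heatKernel ν t x y / t) (𝓝[>] 0) (𝓝 (jumpKernel ν x y))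

/-- The semigroup `P_t f(x) = ∫ f(y) p_t(x, y) dy` for `t > 0`, and `P_0 f = f`. (Negative `t` is
never used.) -/
def semigroup {d : ℕ} (ν : Rd d → ℝ) (t : ℝ) (f : Rd d → ℝ) (x : Rd d) : ℝ :=
  if 0 < t then ∫ y, f y * heatKernel ν t x y else f x

/-- `P_t Φ(x) = (P_t f(x), P_t g(x))` for `Φ = (f, g)`. -/
def semigroupPair {d : ℕ} (ν : Rd d → ℝ) (t : ℝ) (Φ : Rd d → ℝ × ℝ) (x : Rd d) : ℝ × ℝ :=
  (semigroup ν t (fun y => (Φ y).1) x, semigroup ν t (fun y => (Φ y).2) x)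

/-- The signed power `a^{⟨κ⟩} = |a|^κ sgn a`, with `0^{⟨κ⟩} = 0`. -/
def signedPow (a κ : ℝ) : ℝ :=
  |a| ^ κ * Real.sign a

/-- The Bregman co-divergence `𝒥_p(w, z)`: the second-order Taylor remainder of
`z ↦ z₁ z₂^{⟨p-1⟩}` when the argument changes from `w` to `z`. For `p = 2` the factor
`|w₂|^{p-2}` is `1`, also at `w₂ = 0`. -/
def bregmanCoDivergence (p : ℝ) (w z : ℝ × ℝ) : ℝ :=
  z.1 * signedPow z.2 (p - 1) - w.1 * signedPow w.2 (p - 1)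
    - signedPow w.2 (p - 1) * (z.1 - w.1)
    - (p - 1) * w.1 * |w.2| ^ (p - 2) * (z.2 - w.2)

end HardyStein

end

/-! ### Positivity of cosine transforms -/

namespace HardyStein

/-! Let `Y` be a convex potential on pairs, `B` its Bregman divergence and G(t) = ∫ Y(P_tΦ) dx.
Since p_s has mass one and `Y z - B(w, z)` is affine in z, averaging over the kernel gives ∬ B(W(x),
U(y)) p_s(x,y) = ∫ Y(U) - ∫ Y(P_s U) + ∫ B(W, P_s U) (`integral_bregman_mul_kernel`). Take U = P_tΦ.
With base W = P_{t+s}Φ the last term vanishes and the average is exactly G(t) - G(t+s); with W =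
P_tΦ it is at least that. Divided by s and integrated over t, the difference telescopes to a number
between G(s) and G(0), because G decreases to 0.

Now let s → 0, so that p_s/s → ν. Fatou's lemma in the shifted version bounds the integral of B ν by
G(0). This finite bound, together with p_s/s ≤ c ν, makes c B ν an integrable majorant in the
unshifted version; dominated convergence and the continuity of G at 0 give the reverse inequality.
The semigroup is never differentiated in time.

The co-divergence itself has no sign, since w₁ w₂^⟨p-1⟩ is not convex. But the signed power is κ - μ
with κ, μ convex (`exists_isConvexPower_sub`), and w₁ κ(w₂) + |w|^p is convex on the half-plane w₁ ≥
0 (`IsConvexPower.isConvexPotential`). In the difference of the two potentials |w|^p cancels, so the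
co-divergence is a difference of two nonnegative divergences, each with finite integral. If f ≥ 0
the semigroup stays in the half-plane; general f follows by splitting into positive and negative
parts.

What is needed of p_t is collected in `IsHeatKernel` and derived from the Fourier formula:
nonnegativity by approximating e^{-tψ}, mass one and the convolution law by Fourier inversion. -/

/-- The cosine transform of `χ` is nonnegative everywhere. -/
def CosPositive {d : ℕ} (χ : Rd d → ℝ) : Prop :=
  ∀ x : Rd d, 0 ≤ ∫ ξ : Rd d, Real.cos (inner ℝ ξ x) * χ ξ

variable {d : ℕ}

lemma continuous_cos_inner (x : Rd d) : Continuous fun ξ : Rd d => Real.cos (inner ℝ ξ x) := by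
  fun_prop

lemma Integrable.cos_inner_mul {χ : Rd d → ℝ} (hχ : Integrable χ) (x : Rd d) :
    Integrable fun ξ : Rd d => Real.cos (inner ℝ ξ x) * χ ξ := by
  refine hχ.bdd_mul (c := 1) (continuous_cos_inner x).aestronglyMeasurable ?_
  exact Eventually.of_forall fun ξ => by simpa using Real.abs_cos_le_one _

lemma Integrable.cos_inner_mul' {χ : Rd d → ℝ} (hχ : Integrable χ) (x : Rd d) :
    Integrable fun ξ : Rd d => Real.cos (inner ℝ x ξ) * χ ξ := by
  simpa only [real_inner_comm] using Integrable.cos_inner_mul hχ x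

lemma Integrable.sin_inner_mul' {χ : Rd d → ℝ} (hχ : Integrable χ) (x : Rd d) :
    Integrable fun ξ : Rd d => Real.sin (inner ℝ x ξ) * χ ξ := by
  refine hχ.bdd_mul (c := 1) (by fun_prop) ?_
  exact Eventually.of_forall fun ξ => by simpa using Real.abs_sin_le_one _

lemma integral_sin_mul_eq_zero {ρ : Rd d → ℝ} (hsymm : ∀ z, ρ (-z) = ρ z) (ξ : Rd d) :
    ∫ y, Real.sin (inner ℝ ξ y) * ρ y = 0 := by
  have h := integral_neg_eq_self (fun y : Rd d => Real.sin (inner ℝ ξ y) * ρ y) volume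
  simp only [inner_neg_right, Real.sin_neg, hsymm, neg_mul, integral_neg] at h
  linarith

lemma integral_cos_sub_mul {ρ : Rd d → ℝ} (hρ : Integrable ρ) (hsymm : ∀ z, ρ (-z) = ρ z)
    (ξ x : Rd d) :
    ∫ y, Real.cos (inner ℝ ξ (x - y)) * ρ y
      = Real.cos (inner ℝ ξ x) * ∫ y, Real.cos (inner ℝ ξ y) * ρ y := by
  have h1 : ∀ y, Real.cos (inner ℝ ξ (x - y)) * ρ y =
      Real.cos (inner ℝ ξ x) * (Real.cos (inner ℝ ξ y) * ρ y)
      + Real.sin (inner ℝ ξ x) * (Real.sin (inner ℝ ξ y) * ρ y) := by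
    intro y
    rw [inner_sub_right, Real.cos_sub]; ring
  simp_rw [h1]
  rw [integral_add ((Integrable.cos_inner_mul' hρ ξ).const_mul _)
    ((Integrable.sin_inner_mul' hρ ξ).const_mul _), integral_const_mul, integral_const_mul,
    integral_sin_mul_eq_zero hsymm, mul_zero, add_zero]

/-- Multiplying by a cosine transform is a convolution on the transform side. -/
lemma integral_cos_mul_cosTransform {χ ρ : Rd d → ℝ} (hχ : Integrable χ) (hρ : Integrable ρ)
    (hsymm : ∀ z, ρ (-z) = ρ z) (x : Rd d) :
    ∫ ξ : Rd d, Real.cos (inner ℝ ξ x) * (χ ξ * ∫ y, Real.cos (inner ℝ ξ y) * ρ y)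
      = ∫ y, ρ y * ∫ ξ : Rd d, Real.cos (inner ℝ ξ (x - y)) * χ ξ := by
  have hint : Integrable (fun q : Rd d × Rd d =>
      Real.cos (inner ℝ q.1 (x - q.2)) * (χ q.1 * ρ q.2)) (volume.prod volume) := by
    refine (hχ.mul_prod hρ).bdd_mul (c := 1) ?_ ?_
    · exact (by fun_prop : Continuous fun q : Rd d × Rd d =>
        Real.cos (inner ℝ q.1 (x - q.2))).aestronglyMeasurable
    · exact Eventually.of_forall fun ξ => by simpa using Real.abs_cos_le_one _
  calc _ = ∫ ξ : Rd d, ∫ y : Rd d, Real.cos (inner ℝ ξ (x - y)) * (χ ξ * ρ y) := by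
        congr 1; ext ξ
        have : ∀ y, Real.cos (inner ℝ ξ (x - y)) * (χ ξ * ρ y)
          = χ ξ * (Real.cos (inner ℝ ξ (x - y)) * ρ y) := fun y => by ring
        simp_rw [this]
        rw [integral_const_mul, integral_cos_sub_mul hρ hsymm]; ring
    _ = ∫ y : Rd d, ∫ ξ : Rd d, Real.cos (inner ℝ ξ (x - y)) * (χ ξ * ρ y) :=
        integral_integral_swap hint
    _ = _ := by
        congr 1; ext y
        rw [← integral_const_mul]
        congr 1; ext ξ; ring

/-- The new transform is a superposition of translates of the old one with nonnegative weights `ρ`.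
-/
lemma CosPositive.mul_cosTransform {χ ρ : Rd d → ℝ} (h : CosPositive χ) (hχ : Integrable χ)
    (hρ : Integrable ρ) (hsymm : ∀ z, ρ (-z) = ρ z) (h0 : ∀ z, 0 ≤ ρ z) :
    CosPositive fun ξ => χ ξ * ∫ y, Real.cos (inner ℝ ξ y) * ρ y := by
  intro x
  rw [integral_cos_mul_cosTransform hχ hρ hsymm]
  exact integral_nonneg fun y => mul_nonneg (h0 y) (h _)

lemma CosPositive.of_tendsto {χn : ℕ → Rd d → ℝ} {χ b : Rd d → ℝ}
    (h : ∀ᶠ n in atTop, CosPositive (χn n))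
    (hm : ∀ n, AEStronglyMeasurable (χn n)) (hb : Integrable b) (hle : ∀ n ξ, |χn n ξ| ≤ b ξ)
    (hlim : ∀ ξ, Tendsto (fun n => χn n ξ) atTop (𝓝 (χ ξ))) : CosPositive χ := by
  intro x
  refine ge_of_tendsto (f := fun n => ∫ ξ : Rd d, Real.cos (inner ℝ ξ x) * χn n ξ)
    (x := atTop) ?_ (h.mono fun n hn => hn x)
  refine tendsto_integral_of_dominated_convergence b ?_ hb ?_ ?_
  · exact fun n => (continuous_cos_inner x).aestronglyMeasurable.mul (hm n)
  · intro n
    refine Eventually.of_forall fun ξ => ?_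
    rw [norm_mul, Real.norm_eq_abs, Real.norm_eq_abs]
    calc _ ≤ 1 * |χn n ξ| := by gcongr; exact Real.abs_cos_le_one _
      _ ≤ b ξ := by simpa using hle n ξ
  · exact Eventually.of_forall fun ξ => (hlim ξ).const_mul _

lemma continuous_cosTransform {ρ : Rd d → ℝ} (hρ : Integrable ρ) :
    Continuous fun ξ : Rd d => ∫ y, Real.cos (inner ℝ ξ y) * ρ y := by
  refine continuous_of_dominated (bound := fun y => |ρ y|) ?_ ?_ hρ.abs ?_
  · exact fun ξ => (Integrable.cos_inner_mul' hρ ξ).aestronglyMeasurable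
  · intro ξ
    refine Eventually.of_forall fun y => ?_
    rw [norm_mul, Real.norm_eq_abs, Real.norm_eq_abs]
    exact mul_le_of_le_one_left (abs_nonneg _) (Real.abs_cos_le_one _)
  · exact Eventually.of_forall fun y => by fun_prop

lemma abs_cosTransform_le {ρ : Rd d → ℝ} (hρ : Integrable ρ) (h0 : ∀ z, 0 ≤ ρ z) (ξ : Rd d) :
    |∫ y, Real.cos (inner ℝ ξ y) * ρ y| ≤ ∫ y, ρ y := by
  rw [← Real.norm_eq_abs]
  refine norm_integral_le_of_norm_le hρ (Eventually.of_forall fun y => ?_)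
  rw [norm_mul, Real.norm_eq_abs, Real.norm_eq_abs, abs_of_nonneg (h0 y)]
  exact mul_le_of_le_one_left (h0 y) (Real.abs_cos_le_one _)

/-- Integrability is carried through the induction because the convolution identity needs it at each
step. -/
lemma CosPositive.mul_one_add_pow {χ ρ : Rd d → ℝ} (h : CosPositive χ) (hχ : Integrable χ)
    (hρ : Integrable ρ) (hsymm : ∀ z, ρ (-z) = ρ z) (h0 : ∀ z, 0 ≤ ρ z) {s : ℝ} (hs : 0 ≤ s)
    (n : ℕ) :
    CosPositive (fun ξ => χ ξ * (1 + s * ∫ y, Real.cos (inner ℝ ξ y) * ρ y) ^ n) ∧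
    Integrable (fun ξ : Rd d => χ ξ * (1 + s * ∫ y, Real.cos (inner ℝ ξ y) * ρ y) ^ n) := by
  induction n with
  | zero => simpa using ⟨h, hχ⟩
  | succ n ih =>
    obtain ⟨ih1, ih2⟩ := ih
    have hI : Integrable (fun ξ : Rd d => (χ ξ * (1 + s * ∫ y, Real.cos (inner ℝ ξ y) * ρ y) ^ n)
        * ∫ y, Real.cos (inner ℝ ξ y) * ρ y) :=
      ih2.mul_bdd (c := ∫ y, ρ y) (continuous_cosTransform hρ).aestronglyMeasurable
        (Eventually.of_forall fun ξ => abs_cosTransform_le hρ h0 ξ)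
    have e : ∀ ξ : Rd d, χ ξ * (1 + s * ∫ y, Real.cos (inner ℝ ξ y) * ρ y) ^ (n + 1)
        = χ ξ * (1 + s * ∫ y, Real.cos (inner ℝ ξ y) * ρ y) ^ n +
          s * ((χ ξ * (1 + s * ∫ y, Real.cos (inner ℝ ξ y) * ρ y) ^ n)
            * ∫ y, Real.cos (inner ℝ ξ y) * ρ y) := fun ξ => by ring
    simp_rw [e]
    refine ⟨fun x => ?_, ih2.add (hI.const_mul s)⟩
    simp_rw [mul_add]
    have e2 : ∀ ξ : Rd d, Real.cos (inner ℝ ξ x) *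
        (s * ((χ ξ * (1 + s * ∫ y, Real.cos (inner ℝ ξ y) * ρ y) ^ n)
            * ∫ y, Real.cos (inner ℝ ξ y) * ρ y)) = s * (Real.cos (inner ℝ ξ x) *
        ((χ ξ * (1 + s * ∫ y, Real.cos (inner ℝ ξ y) * ρ y) ^ n)
            * ∫ y, Real.cos (inner ℝ ξ y) * ρ y)) := fun ξ => by ring
    simp_rw [e2]
    rw [integral_add (Integrable.cos_inner_mul ih2 x)
      ((Integrable.cos_inner_mul hI x).const_mul s), integral_const_mul]
    exact add_nonneg (ih1 x) (mul_nonneg hs (ih1.mul_cosTransform ih2 hρ hsymm h0 x))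

lemma CosPositive.mul_exp {χ ρ : Rd d → ℝ} (h : CosPositive χ) (hχ : Integrable χ)
    (hρ : Integrable ρ) (hsymm : ∀ z, ρ (-z) = ρ z) (h0 : ∀ z, 0 ≤ ρ z) {t : ℝ} (ht : 0 ≤ t) :
    CosPositive (fun ξ => χ ξ * Real.exp (t * ∫ y, Real.cos (inner ℝ ξ y) * ρ y)) := by
  refine CosPositive.of_tendsto (b := fun ξ => |χ ξ| * Real.exp (t * ∫ y, ρ y))
    (χn := fun n ξ => χ ξ * (1 + (t / n) * ∫ y, Real.cos (inner ℝ ξ y) * ρ y) ^ n)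
    (Eventually.of_forall fun n => (h.mul_one_add_pow hχ hρ hsymm h0 (by positivity) n).1)
    (fun n => (h.mul_one_add_pow hχ hρ hsymm h0 (by positivity) n).2.aestronglyMeasurable)
    (hχ.abs.mul_const _) ?_ ?_
  · intro n ξ
    rw [abs_mul, abs_pow]
    gcongr
    have hA := abs_cosTransform_le hρ h0 ξ
    set A := ∫ y, Real.cos (inner ℝ ξ y) * ρ y
    have h1 : |1 + t / n * A| ≤ Real.exp (t / n * ∫ y, ρ y) := by
      calc |1 + t / n * A| ≤ |1| + |t / n * A| := abs_add_le _ _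
        _ = 1 + t / n * |A| := by rw [abs_mul, abs_of_nonneg (by positivity : 0 ≤ t / n)]; simp
        _ ≤ 1 + t / n * ∫ y, ρ y := by gcongr
        _ ≤ _ := by linarith [Real.add_one_le_exp (t / n * ∫ y, ρ y)]
    calc |1 + t / n * A| ^ n ≤ (Real.exp (t / n * ∫ y, ρ y)) ^ n := by gcongr
      _ = Real.exp (n * (t / n * ∫ y, ρ y)) := (Real.exp_nat_mul _ _).symm
      _ ≤ _ := by
        -- For `n = 0` the quotient `t / n` is 0 by convention, so the factor `n` does not cancel.
        rcases Nat.eq_zero_or_pos n with rfl | hn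
        · simp only [Nat.cast_zero, zero_mul, Real.exp_zero]
          exact Real.one_le_exp (mul_nonneg ht (integral_nonneg h0))
        · rw [← mul_assoc, mul_div_cancel₀]
          positivity
  · intro ξ
    refine Tendsto.const_mul _ ?_
    have := Real.tendsto_one_add_div_pow_exp (t * ∫ y, Real.cos (inner ℝ ξ y) * ρ y)
    refine this.congr fun n => ?_
    ring

/-- An integrable starting point for the multiplications above; the constant 1 would not be
integrable. -/
lemma cosPositive_gaussian {b : ℝ} (hb : 0 < b) :
    CosPositive (fun ξ : Rd d => Real.exp (-b * ‖ξ‖ ^ 2)) ∧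
    Integrable (fun ξ : Rd d => Real.exp (-b * ‖ξ‖ ^ 2)) := by
  have hI : ∀ x : Rd d, Integrable fun ξ : Rd d =>
      Complex.exp (-(b : ℂ) * ‖ξ‖ ^ 2 + Complex.I * ((inner ℝ x ξ : ℝ) : ℂ)) := fun x =>
    GaussianFourier.integrable_cexp_neg_mul_sq_norm_add (by simpa using hb) _ _
  have hre : ∀ x ξ : Rd d,
      (Complex.exp (-(b : ℂ) * ‖ξ‖ ^ 2 + Complex.I * ((inner ℝ x ξ : ℝ) : ℂ))).re
      = Real.cos (inner ℝ ξ x) * Real.exp (-b * ‖ξ‖ ^ 2) := by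
    intro x ξ
    rw [Complex.exp_re, real_inner_comm]
    simp [← Complex.ofReal_pow, mul_comm]
  constructor
  · intro x
    have h := GaussianFourier.integral_cexp_neg_mul_sq_norm_add (b := (b : ℂ))
      (by simpa using hb) Complex.I x
    have h2 := congrArg Complex.re h
    rw [show ∀ z : ℂ, z.re = RCLike.re z from fun _ => rfl, ← integral_re (hI x)] at h2
    simp only [RCLike.re_to_complex, hre] at h2
    rw [h2]
    have : ((Real.pi / b : ℂ) ^ (Module.finrank ℝ (Rd d) / 2 : ℂ) *
        Complex.exp (Complex.I ^ 2 * ‖x‖ ^ 2 / (4 * b))) =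
        (((Real.pi / b) ^ ((Module.finrank ℝ (Rd d) : ℝ) / 2) *
          Real.exp (- ‖x‖ ^ 2 / (4 * b)) : ℝ) : ℂ) := by
      rw [Complex.ofReal_mul, Complex.ofReal_cpow (by positivity), Complex.ofReal_exp]
      push_cast
      rw [Complex.I_sq, neg_one_mul]
    rw [this, Complex.ofReal_re]
    positivity
  · refine ((hI 0).re).congr (Eventually.of_forall fun ξ => ?_)
    simp only [RCLike.re_to_complex, hre]
    simp

end HardyStein

/-! ### The Lévy–Khinchine exponent -/

namespace HardyStein

variable {d : ℕ} {ν : Rd d → ℝ}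

lemma IsLevyDensity.min_mul_nonneg (hν : IsLevyDensity ν) (x : Rd d) :
    0 ≤ min (‖x‖ ^ 2) 1 * ν x := by
  rcases eq_or_ne x 0 with rfl | hx
  · simp
  · have := hν.pos x hx
    positivity

lemma IsLevyDensity.neg (hν : IsLevyDensity ν) (x : Rd d) : ν (-x) = ν x := by
  rcases eq_or_ne x 0 with rfl | hx
  · simp
  · exact hν.symm x hx

lemma one_sub_cos_inner_le (ξ x : Rd d) :
    1 - Real.cos (inner ℝ ξ x) ≤ 2 * (1 + ‖ξ‖ ^ 2) * min (‖x‖ ^ 2) 1 := by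
  rcases le_total (‖x‖ ^ 2) 1 with h | h
  · rw [min_eq_left h]
    have h1 := Real.one_sub_sq_div_two_le_cos (x := inner ℝ ξ x)
    have h2 : (inner ℝ ξ x : ℝ) ^ 2 ≤ ‖ξ‖ ^ 2 * ‖x‖ ^ 2 := by
      rw [← mul_pow, ← sq_abs]
      gcongr
      exact abs_real_inner_le_norm ξ x
    nlinarith [sq_nonneg ‖x‖, sq_nonneg ‖ξ‖, mul_nonneg (sq_nonneg ‖ξ‖) (sq_nonneg ‖x‖)]
  · rw [min_eq_right h]
    nlinarith [Real.neg_one_le_cos (inner ℝ ξ x), sq_nonneg ‖ξ‖]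

lemma IsLevyDensity.one_sub_cos_mul_nonneg (hν : IsLevyDensity ν) (ξ x : Rd d) :
    0 ≤ (1 - Real.cos (inner ℝ ξ x)) * ν x := by
  rcases eq_or_ne x 0 with rfl | hx
  · simp
  · exact mul_nonneg (by linarith [Real.cos_le_one (inner ℝ ξ x)]) (hν.pos x hx).le

lemma IsLevyDensity.one_sub_cos_mul_le (hν : IsLevyDensity ν) (ξ x : Rd d) :
    (1 - Real.cos (inner ℝ ξ x)) * ν x
      ≤ 2 * (1 + ‖ξ‖ ^ 2) * (min (‖x‖ ^ 2) 1 * ν x) := by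
  rcases eq_or_ne x 0 with rfl | hx
  · simp
  · rw [← mul_assoc]
    exact mul_le_mul_of_nonneg_right (one_sub_cos_inner_le ξ x) (hν.pos x hx).le

lemma IsLevyDensity.aestronglyMeasurable_one_sub_cos_mul (hν : IsLevyDensity ν) (ξ : Rd d) :
    AEStronglyMeasurable fun x => (1 - Real.cos (inner ℝ ξ x)) * ν x :=
  ((by fun_prop : Continuous fun x : Rd d => 1 - Real.cos (inner ℝ ξ x)).measurable.mul
    hν.measurable).aestronglyMeasurable

lemma IsLevyDensity.integrable_one_sub_cos_mul (hν : IsLevyDensity ν) (ξ : Rd d) :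
    Integrable fun x => (1 - Real.cos (inner ℝ ξ x)) * ν x := by
  refine (hν.integrable.const_mul (2 * (1 + ‖ξ‖ ^ 2))).mono'
    (hν.aestronglyMeasurable_one_sub_cos_mul ξ) (Eventually.of_forall fun x => ?_)
  rw [Real.norm_eq_abs, abs_of_nonneg (hν.one_sub_cos_mul_nonneg ξ x)]
  exact hν.one_sub_cos_mul_le ξ x

lemma levyExponent_nonneg (hν : IsLevyDensity ν) (ξ : Rd d) : 0 ≤ levyExponent ν ξ :=
  integral_nonneg fun x => hν.one_sub_cos_mul_nonneg ξ x

lemma levyExponent_neg (ξ : Rd d) : levyExponent ν (-ξ) = levyExponent ν ξ := by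
  simp [levyExponent]

lemma continuous_levyExponent (hν : IsLevyDensity ν) : Continuous (levyExponent ν) := by
  rw [continuous_iff_continuousAt]
  intro ξ₀
  refine continuousAt_of_dominated
    (bound := fun x => 2 * (1 + (‖ξ₀‖ + 1) ^ 2) * (min (‖x‖ ^ 2) 1 * ν x)) ?_ ?_
    (hν.integrable.const_mul _) ?_
  · exact Eventually.of_forall fun ξ => hν.aestronglyMeasurable_one_sub_cos_mul ξ
  · filter_upwards [Metric.ball_mem_nhds ξ₀ one_pos] with ξ hξ
    refine Eventually.of_forall fun x => ?_
    rw [Real.norm_eq_abs, abs_of_nonneg (hν.one_sub_cos_mul_nonneg ξ x)]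
    refine (hν.one_sub_cos_mul_le ξ x).trans ?_
    have := hν.min_mul_nonneg x
    gcongr
    have h1 : ‖ξ - ξ₀‖ < 1 := by simpa [dist_eq_norm] using hξ
    have h2 := norm_sub_norm_le ξ ξ₀
    linarith
  · exact Eventually.of_forall fun x => by fun_prop

/-- On the open strip 0 < ξ·x < 2π, which is nonempty, the integrand is strictly positive. This is
what forces e^{-tψ} → 0 as t → ∞, and hence the decay of the semigroup. -/
lemma levyExponent_pos (hν : IsLevyDensity ν) {ξ : Rd d} (hξ : ξ ≠ 0) :
    0 < levyExponent ν ξ := by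
  unfold levyExponent
  rw [integral_pos_iff_support_of_nonneg (fun x => hν.one_sub_cos_mul_nonneg ξ x)
    (hν.integrable_one_sub_cos_mul ξ)]
  set U : Set (Rd d) := (fun x : Rd d => (inner ℝ ξ x : ℝ)) ⁻¹' Ioo 0 (2 * Real.pi)
  have hU : IsOpen U := isOpen_Ioo.preimage (by fun_prop)
  have hn : 0 < ‖ξ‖ ^ 2 := by positivity
  have hne : U.Nonempty := by
    refine ⟨(Real.pi / ‖ξ‖ ^ 2) • ξ, ?_⟩
    simp only [U, mem_preimage, inner_smul_right, real_inner_self_eq_norm_sq, mem_Ioo]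
    rw [div_mul_cancel₀ _ hn.ne']
    constructor <;> linarith [Real.pi_pos]
  refine (hU.measure_pos volume hne).trans_le (measure_mono ?_)
  intro x hx
  have hx' : 0 < (inner ℝ ξ x : ℝ) ∧ (inner ℝ ξ x : ℝ) < 2 * Real.pi := hx
  have hx0 : x ≠ 0 := by
    rintro rfl
    simp at hx'
  have hc : Real.cos (inner ℝ ξ x) ≠ 1 := by
    intro h
    rw [Real.cos_eq_one_iff_of_lt_of_lt (by linarith [Real.pi_pos]) hx'.2] at h
    linarith
  exact mul_ne_zero (sub_ne_zero.mpr hc.symm) (hν.pos x hx0).ne'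

lemma IsLevyDensity.integrable_truncation (hν : IsLevyDensity ν) {ε : ℝ} (hε : 0 < ε)
    (hε1 : ε ≤ 1) : Integrable ({x : Rd d | ε ≤ ‖x‖}.indicator ν) := by
  have hS : MeasurableSet {x : Rd d | ε ≤ ‖x‖} := measurableSet_le measurable_const measurable_norm
  refine (hν.integrable.const_mul (ε ^ 2)⁻¹).mono'
    (hν.measurable.indicator hS).aestronglyMeasurable (Eventually.of_forall fun x => ?_)
  by_cases hx : ε ≤ ‖x‖
  · rw [indicator_of_mem (show x ∈ {x : Rd d | ε ≤ ‖x‖} from hx)]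
    have hx0 : x ≠ 0 := by
      rintro rfl
      simp at hx; linarith
    have hp := hν.pos x hx0
    rw [Real.norm_eq_abs, abs_of_pos hp, ← mul_assoc]
    refine le_mul_of_one_le_left hp.le ?_
    rw [← div_eq_inv_mul, one_le_div (by positivity)]
    exact le_min (by gcongr) (by nlinarith)
  · rw [indicator_of_notMem (show x ∉ {x : Rd d | ε ≤ ‖x‖} from hx)]
    have := hν.min_mul_nonneg x
    simp only [norm_zero]
    positivity

/-- Away from the origin `ν` has finite mass, so the truncated exponent splits as mass minus cosine
transform. Its negative exponential is then a positive constant times the exponential of a cosine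
transform, as in `CosPositive.mul_exp`. -/
lemma tendsto_truncated_exponent (hν : IsLevyDensity ν) (ξ : Rd d) :
    Tendsto (fun n : ℕ => (∫ y, {x : Rd d | 1 / ((n : ℝ) + 1) ≤ ‖x‖}.indicator ν y) -
      ∫ y, Real.cos (inner ℝ ξ y) * {x : Rd d | 1 / ((n : ℝ) + 1) ≤ ‖x‖}.indicator ν y)
      atTop (𝓝 (levyExponent ν ξ)) := by
  have hI : ∀ n : ℕ, Integrable ({x : Rd d | 1 / ((n : ℝ) + 1) ≤ ‖x‖}.indicator ν) := fun n =>
    hν.integrable_truncation Nat.one_div_pos_of_nat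
      (by rw [div_le_one (by positivity)]; linarith [n.cast_nonneg (α := ℝ)])
  have hS : ∀ n : ℕ, MeasurableSet {x : Rd d | 1 / ((n : ℝ) + 1) ≤ ‖x‖} := fun n =>
    measurableSet_le measurable_const measurable_norm
  have e : ∀ n : ℕ, (∫ y, {x : Rd d | 1 / ((n : ℝ) + 1) ≤ ‖x‖}.indicator ν y) -
      ∫ y, Real.cos (inner ℝ ξ y) * {x : Rd d | 1 / ((n : ℝ) + 1) ≤ ‖x‖}.indicator ν y
      = ∫ y, {x : Rd d | 1 / ((n : ℝ) + 1) ≤ ‖x‖}.indicator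
          (fun y => (1 - Real.cos (inner ℝ ξ y)) * ν y) y := by
    intro n
    rw [← integral_sub (hI n) (Integrable.cos_inner_mul' (hI n) ξ)]
    congr 1; ext y
    simp only [indicator]
    split_ifs <;> ring
  simp_rw [e]
  refine tendsto_integral_of_dominated_convergence
    (fun y => (1 - Real.cos (inner ℝ ξ y)) * ν y) ?_ (hν.integrable_one_sub_cos_mul ξ) ?_ ?_
  · exact fun n => (hν.aestronglyMeasurable_one_sub_cos_mul ξ).indicator (hS n)
  · intro n
    refine Eventually.of_forall fun y => ?_
    rw [Real.norm_eq_abs, abs_of_nonneg (indicator_nonneg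
      (fun y _ => hν.one_sub_cos_mul_nonneg ξ y) y)]
    exact indicator_le_self' (fun y _ => hν.one_sub_cos_mul_nonneg ξ y) y
  · refine Eventually.of_forall fun y => ?_
    rcases eq_or_ne y 0 with rfl | hy
    · simp [indicator]
    · refine tendsto_const_nhds.congr' ?_
      have := tendsto_one_div_add_atTop_nhds_zero_nat (𝕜 := ℝ)
      filter_upwards [this.eventually_le_const (norm_pos_iff.mpr hy)] with n hn
      rw [indicator_of_mem]
      exact hn

/-- The Hartman–Wintner condition gives tψ(ξ) ≥ (d+1) log|ξ| for large |ξ|, hence decay of order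
|ξ|^{-(d+1)}. -/
lemma integrable_exp_neg_levyExponent (hν : IsLevyDensity ν) (hHW : HartmanWintner ν) {t : ℝ}
    (ht : 0 < t) : Integrable fun ξ : Rd d => Real.exp (-(t * levyExponent ν ξ)) := by
  have h1 := hHW.eventually_ge_atTop (((d : ℝ) + 1) / t)
  obtain ⟨R, hR⟩ := (Metric.hasBasis_cobounded_compl_closedBall (0 : Rd d)).eventually_iff.mp h1
  obtain ⟨_, hR⟩ := hR
  set R' := max R 1
  have hR1 : 1 ≤ R' := le_max_right _ _
  have hd : (Module.finrank ℝ (Rd d) : ℝ) < (d : ℝ) + 1 := by simp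
  -- The constant makes the majorant at least 1 on the ball of radius `R'` and at least |ξ|^{-(d+1)}
  -- outside it.
  have hI := (integrable_one_add_norm (E := Rd d) (μ := volume) hd).const_mul
    ((1 + R') ^ ((d : ℝ) + 1))
  refine hI.mono' ?_ (Eventually.of_forall fun ξ => ?_)
  · have := continuous_levyExponent hν
    exact (by fun_prop : Continuous fun ξ : Rd d =>
      Real.exp (-(t * levyExponent ν ξ))).aestronglyMeasurable
  · rw [Real.norm_eq_abs, Real.abs_exp, Real.rpow_neg (by positivity), ← div_eq_mul_inv,
      ← Real.div_rpow (by positivity) (by positivity)]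
    by_cases hξ : ‖ξ‖ ≤ R'
    · calc Real.exp (-(t * levyExponent ν ξ)) ≤ 1 := by
            rw [Real.exp_le_one_iff]
            have := levyExponent_nonneg hν ξ
            simp only [Left.neg_nonpos_iff]; positivity
        _ ≤ _ := Real.one_le_rpow (by rw [one_le_div (by positivity)]; linarith) (by positivity)
    · push Not at hξ
      have hξ1 : 1 < ‖ξ‖ := hR1.trans_lt hξ
      have h2 : ((d : ℝ) + 1) / t ≤ levyExponent ν ξ / Real.log ‖ξ‖ := by
        apply hR
        simp only [mem_compl_iff, Metric.mem_closedBall, dist_zero_right, not_le]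
        exact (le_max_left _ _).trans_lt hξ
      have hlog : 0 < Real.log ‖ξ‖ := Real.log_pos hξ1
      rw [div_le_div_iff₀ ht hlog] at h2
      calc Real.exp (-(t * levyExponent ν ξ)) ≤ Real.exp (-(((d : ℝ) + 1) * Real.log ‖ξ‖)) := by
            rw [Real.exp_le_exp]; linarith
        _ = (1 / ‖ξ‖) ^ ((d : ℝ) + 1) := by
            rw [Real.rpow_def_of_pos (by positivity), one_div, Real.log_inv]
            congr 1; ring
        _ ≤ _ := by
            refine Real.rpow_le_rpow (by positivity) ?_ (by positivity)
            rw [div_le_div_iff₀ (by linarith) (by linarith)]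
            nlinarith

lemma measurable_levyExponent (hν : IsLevyDensity ν) : Measurable (levyExponent ν) :=
  (continuous_levyExponent hν).measurable

/-- Two limits: with a fixed Gaussian factor as majorant the truncation of `ν` is removed, and then
the Gaussian factor is removed, dominated by e^{-tψ} itself. -/
lemma cosPositive_exp_neg_levyExponent (hν : IsLevyDensity ν) (hHW : HartmanWintner ν) {t : ℝ}
    (ht : 0 < t) : CosPositive fun ξ : Rd d => Real.exp (-(t * levyExponent ν ξ)) := by
  have hm := continuous_levyExponent hν
  have key : ∀ b : ℝ, 0 < b → CosPositive fun ξ : Rd d =>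
      Real.exp (-b * ‖ξ‖ ^ 2) * Real.exp (-(t * levyExponent ν ξ)) := by
    intro b hb
    obtain ⟨hg, hgi⟩ := cosPositive_gaussian (d := d) hb
    have hI : ∀ n : ℕ, Integrable ({x : Rd d | 1 / ((n : ℝ) + 1) ≤ ‖x‖}.indicator ν) := fun n =>
      hν.integrable_truncation Nat.one_div_pos_of_nat
        (by rw [div_le_one (by positivity)]; linarith [n.cast_nonneg (α := ℝ)])
    have h0 : ∀ (n : ℕ) z, 0 ≤ {x : Rd d | 1 / ((n : ℝ) + 1) ≤ ‖x‖}.indicator ν z := by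
      intro n
      refine fun z => indicator_nonneg (fun x hx => (hν.pos x ?_).le) z
      rintro rfl
      have : (0 : ℝ) < 1 / ((n : ℝ) + 1) := Nat.one_div_pos_of_nat
      simp only [mem_ofPred_eq, norm_zero] at hx
      linarith
    have hs : ∀ (n : ℕ) z, {x : Rd d | 1 / ((n : ℝ) + 1) ≤ ‖x‖}.indicator ν (-z)
        = {x : Rd d | 1 / ((n : ℝ) + 1) ≤ ‖x‖}.indicator ν z := by
      intro n z
      simp [indicator, hν.neg z]
    have hexp : ∀ (n : ℕ) (ξ : Rd d),
        Real.exp (-(t * ((∫ y, {x : Rd d | 1 / ((n : ℝ) + 1) ≤ ‖x‖}.indicator ν y) -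
        ∫ y, Real.cos (inner ℝ ξ y) * {x : Rd d | 1 / ((n : ℝ) + 1) ≤ ‖x‖}.indicator ν y)))
        = Real.exp (-(t * ∫ y, {x : Rd d | 1 / ((n : ℝ) + 1) ≤ ‖x‖}.indicator ν y)) *
        Real.exp (t * ∫ y, Real.cos (inner ℝ ξ y) *
          {x : Rd d | 1 / ((n : ℝ) + 1) ≤ ‖x‖}.indicator ν y) := by
      intro n ξ
      rw [← Real.exp_add]; congr 1; ring
    refine CosPositive.of_tendsto (b := fun ξ => Real.exp (-b * ‖ξ‖ ^ 2))
      (χn := fun n ξ => Real.exp (-b * ‖ξ‖ ^ 2) *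
        Real.exp (-(t * ((∫ y, {x : Rd d | 1 / ((n : ℝ) + 1) ≤ ‖x‖}.indicator ν y) -
        ∫ y, Real.cos (inner ℝ ξ y) * {x : Rd d | 1 / ((n : ℝ) + 1) ≤ ‖x‖}.indicator ν y))))
      (Eventually.of_forall fun n x => ?_) (fun n => ?_) hgi (fun n ξ => ?_) (fun ξ => ?_)
    · have := hg.mul_exp hgi (hI n) (hs n) (h0 n) ht.le x
      simp_rw [hexp]
      have e : ∀ ξ : Rd d, Real.cos (inner ℝ ξ x) * (Real.exp (-b * ‖ξ‖ ^ 2) *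
          (Real.exp (-(t * ∫ y, {x : Rd d | 1 / ((n : ℝ) + 1) ≤ ‖x‖}.indicator ν y)) *
          Real.exp (t * ∫ y, Real.cos (inner ℝ ξ y) *
          {x : Rd d | 1 / ((n : ℝ) + 1) ≤ ‖x‖}.indicator ν y))) =
          Real.exp (-(t * ∫ y, {x : Rd d | 1 / ((n : ℝ) + 1) ≤ ‖x‖}.indicator ν y)) *
          (Real.cos (inner ℝ ξ x) * (Real.exp (-b * ‖ξ‖ ^ 2) *
          Real.exp (t * ∫ y, Real.cos (inner ℝ ξ y) *
          {x : Rd d | 1 / ((n : ℝ) + 1) ≤ ‖x‖}.indicator ν y))) := fun ξ => by ring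
      simp_rw [e]
      rw [integral_const_mul]
      exact mul_nonneg (Real.exp_pos _).le this
    · have := continuous_cosTransform (hI n)
      exact (by fun_prop : Continuous fun ξ : Rd d => Real.exp (-b * ‖ξ‖ ^ 2) *
        Real.exp (-(t * ((∫ y, {x : Rd d | 1 / ((n : ℝ) + 1) ≤ ‖x‖}.indicator ν y) -
        ∫ y, Real.cos (inner ℝ ξ y) *
          {x : Rd d | 1 / ((n : ℝ) + 1) ≤ ‖x‖}.indicator ν y)))).aestronglyMeasurable
    · rw [abs_mul, Real.abs_exp, Real.abs_exp]
      refine mul_le_of_le_one_right (Real.exp_pos _).le ?_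
      rw [Real.exp_le_one_iff, Left.neg_nonpos_iff]
      refine mul_nonneg ht.le (sub_nonneg.mpr ?_)
      exact (le_abs_self _).trans (abs_cosTransform_le (hI n) (h0 n) ξ)
    · refine Tendsto.const_mul _ ((Real.continuous_exp.tendsto _).comp ?_)
      exact ((tendsto_truncated_exponent hν ξ).const_mul t).neg
  refine CosPositive.of_tendsto (b := fun ξ => Real.exp (-(t * levyExponent ν ξ)))
    (χn := fun n ξ => Real.exp (-(1 / ((n : ℝ) + 1)) * ‖ξ‖ ^ 2) *
      Real.exp (-(t * levyExponent ν ξ)))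
    (Eventually.of_forall fun n => key _ Nat.one_div_pos_of_nat) (fun n => ?_)
    (integrable_exp_neg_levyExponent hν hHW ht) (fun n ξ => ?_) (fun ξ => ?_)
  · exact (by fun_prop : Continuous fun ξ : Rd d =>
      Real.exp (-(1 / ((n : ℝ) + 1)) * ‖ξ‖ ^ 2) *
      Real.exp (-(t * levyExponent ν ξ))).aestronglyMeasurable
  · rw [abs_mul, Real.abs_exp, Real.abs_exp]
    refine mul_le_of_le_one_left (Real.exp_pos _).le ?_
    rw [Real.exp_le_one_iff, neg_mul, Left.neg_nonpos_iff]
    positivity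
  · have h1 := tendsto_one_div_add_atTop_nhds_zero_nat (𝕜 := ℝ)
    have h2 : Tendsto (fun n : ℕ => Real.exp (-(1 / ((n : ℝ) + 1)) * ‖ξ‖ ^ 2)) atTop
        (𝓝 (Real.exp (-0 * ‖ξ‖ ^ 2))) :=
      (Real.continuous_exp.tendsto _).comp (h1.neg.mul_const _)
    simpa using h2.mul_const (Real.exp (-(t * levyExponent ν ξ)))

end HardyStein

/-! ### The heat densities -/

namespace HardyStein

open FourierTransform

variable {d : ℕ} {ν : Rd d → ℝ}

lemma heatDensity_eq (hν : IsLevyDensity ν) (hHW : HartmanWintner ν) {t : ℝ} (ht : 0 < t)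
    (x : Rd d) : heatDensity ν t x = ((2 * Real.pi) ^ d)⁻¹ *
      ∫ ξ : Rd d, Real.cos (inner ℝ ξ x) * Real.exp (-(t * levyExponent ν ξ)) := by
  have hI := integrable_exp_neg_levyExponent hν hHW ht
  have hC : Integrable fun ξ : Rd d => Complex.exp (-Complex.I * ((inner ℝ ξ x : ℝ) : ℂ)) *
      Complex.exp (-((t * levyExponent ν ξ : ℝ) : ℂ)) := by
    have h2 : Integrable fun ξ : Rd d => Complex.exp (-((t * levyExponent ν ξ : ℝ) : ℂ)) := by
      refine hI.ofReal.congr (Eventually.of_forall fun ξ => ?_)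
      simp
    refine h2.bdd_mul (c := 1) (by fun_prop) (Eventually.of_forall fun ξ => ?_)
    rw [Complex.norm_exp]
    simp
  unfold heatDensity
  congr 1
  rw [show ∀ z : ℂ, z.re = RCLike.re z from fun _ => rfl, ← integral_re hC]
  congr 1; ext ξ
  rw [← Complex.ofReal_neg, ← Complex.ofReal_exp]
  simp only [RCLike.re_to_complex, Complex.re_mul_ofReal, Complex.exp_re]
  simp

lemma measurable_heatDensity (hν : IsLevyDensity ν) :
    Measurable (Function.uncurry (heatDensity ν)) := by
  have hm := measurable_levyExponent hν
  unfold Function.uncurry heatDensity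
  refine Measurable.const_mul (Complex.measurable_re.comp ?_) _
  refine StronglyMeasurable.measurable ?_
  refine StronglyMeasurable.integral_prod_right
    (f := fun (q : ℝ × Rd d) (ξ : Rd d) => Complex.exp (-Complex.I * ((inner ℝ ξ q.2 : ℝ) : ℂ)) *
      Complex.exp (-((q.1 * levyExponent ν ξ : ℝ) : ℂ))) ?_
  refine Measurable.stronglyMeasurable ?_
  unfold Function.uncurry
  fun_prop

lemma heatDensity_nonneg (hν : IsLevyDensity ν) (hHW : HartmanWintner ν) {t : ℝ} (ht : 0 < t)
    (x : Rd d) : 0 ≤ heatDensity ν t x := by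
  rw [heatDensity_eq hν hHW ht]
  exact mul_nonneg (by positivity) (cosPositive_exp_neg_levyExponent hν hHW ht x)

lemma heatDensity_neg (hν : IsLevyDensity ν) (hHW : HartmanWintner ν) {t : ℝ} (ht : 0 < t)
    (x : Rd d) : heatDensity ν t (-x) = heatDensity ν t x := by
  rw [heatDensity_eq hν hHW ht, heatDensity_eq hν hHW ht]
  simp [inner_neg_right]

lemma heatDensity_le_zero_value (hν : IsLevyDensity ν) (hHW : HartmanWintner ν) {t : ℝ}
    (ht : 0 < t) (x : Rd d) : heatDensity ν t x ≤ ((2 * Real.pi) ^ d)⁻¹ *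
      ∫ ξ : Rd d, Real.exp (-(t * levyExponent ν ξ)) := by
  have hI := integrable_exp_neg_levyExponent hν hHW ht
  rw [heatDensity_eq hν hHW ht]
  refine mul_le_mul_of_nonneg_left (integral_mono (Integrable.cos_inner_mul hI x) hI fun ξ => ?_)
    (by positivity)
  exact mul_le_of_le_one_left (Real.exp_pos _).le (Real.cos_le_one _)

lemma continuousOn_heatDensity (hν : IsLevyDensity ν) (hHW : HartmanWintner ν) (x : Rd d) :
    ContinuousOn (fun t => heatDensity ν t x) (Ioi 0) := by
  have : ContinuousOn (fun t => ((2 * Real.pi) ^ d)⁻¹ *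
      ∫ ξ : Rd d, Real.cos (inner ℝ ξ x) * Real.exp (-(t * levyExponent ν ξ))) (Ioi 0) := by
    refine ContinuousOn.mul continuousOn_const ?_
    intro t₀ ht₀
    have ht₀' : 0 < t₀ := ht₀
    refine ContinuousAt.continuousWithinAt ?_
    refine continuousAt_of_dominated
      (bound := fun ξ => Real.exp (-(t₀ / 2 * levyExponent ν ξ))) ?_ ?_
      (integrable_exp_neg_levyExponent hν hHW (half_pos ht₀')) ?_
    · have hm := continuous_levyExponent hν
      exact Eventually.of_forall fun t => Continuous.aestronglyMeasurable (by fun_prop)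
    · filter_upwards [lt_mem_nhds (half_lt_self ht₀')] with t ht
      refine Eventually.of_forall fun ξ => ?_
      rw [norm_mul, Real.norm_eq_abs, Real.norm_eq_abs, Real.abs_exp]
      refine (mul_le_of_le_one_left (Real.exp_pos _).le (Real.abs_cos_le_one _)).trans ?_
      rw [Real.exp_le_exp, neg_le_neg_iff]
      exact mul_le_mul_of_nonneg_right ht.le (levyExponent_nonneg hν ξ)
    · exact Eventually.of_forall fun ξ => by fun_prop
  exact this.congr fun t ht => heatDensity_eq hν hHW ht x

lemma tendsto_integral_exp_neg_levyExponent (hd : 1 ≤ d) (hν : IsLevyDensity ν)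
    (hHW : HartmanWintner ν) :
    Tendsto (fun t : ℝ => ∫ ξ : Rd d, Real.exp (-(t * levyExponent ν ξ))) atTop (𝓝 0) := by
  have : Nonempty (Fin d) := ⟨⟨0, hd⟩⟩
  have hne : ∀ᵐ ξ : Rd d, ξ ≠ 0 := compl_mem_ae_iff.mpr (measure_singleton 0)
  rw [← integral_zero (Rd d) ℝ (μ := volume)]
  refine tendsto_integral_filter_of_dominated_convergence
    (fun ξ => Real.exp (-(1 * levyExponent ν ξ))) ?_ ?_
    (integrable_exp_neg_levyExponent hν hHW one_pos) ?_
  · have hm := continuous_levyExponent hν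
    exact Eventually.of_forall fun t => Continuous.aestronglyMeasurable (by fun_prop)
  · filter_upwards [eventually_ge_atTop 1] with t ht
    refine Eventually.of_forall fun ξ => ?_
    rw [Real.norm_eq_abs, Real.abs_exp, Real.exp_le_exp, neg_le_neg_iff]
    exact mul_le_mul_of_nonneg_right ht (levyExponent_nonneg hν ξ)
  · filter_upwards [hne] with ξ hξ
    refine Real.tendsto_exp_atBot.comp (tendsto_neg_atTop_atBot.comp ?_)
    exact tendsto_id.atTop_mul_const (levyExponent_pos hν hξ)

/-- In the unit ball the density is bounded; outside it the relative upper bound compares it with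
`ν`, which has finite mass there. -/
lemma integrable_heatDensity (hd : 1 ≤ d) (hν : IsLevyDensity ν) (hHW : HartmanWintner ν) {c : ℝ}
    {t : ℝ} (ht : 0 < t) (hc : ∀ x : Rd d, x ≠ 0 → heatDensity ν t x ≤ c * t * ν x) :
    Integrable (heatDensity ν t) := by
  have : Nonempty (Fin d) := ⟨⟨0, hd⟩⟩
  set M := ((2 * Real.pi) ^ d)⁻¹ * ∫ ξ : Rd d, Real.exp (-(t * levyExponent ν ξ))
  have hI : Integrable fun x : Rd d => (Metric.closedBall (0 : Rd d) 1).indicator (fun _ => M) x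
      + |c * t| * (min (‖x‖ ^ 2) 1 * ν x) := by
    refine Integrable.add ?_ (hν.integrable.const_mul _)
    rw [integrable_indicator_iff measurableSet_closedBall]
    exact integrableOn_const measure_closedBall_lt_top.ne
  refine hI.mono' ?_ (Eventually.of_forall fun x => ?_)
  · exact ((measurable_heatDensity hν).comp measurable_prodMk_left).aestronglyMeasurable
  · rw [Real.norm_eq_abs, abs_of_nonneg (heatDensity_nonneg hν hHW ht x)]
    have h0 := hν.min_mul_nonneg x
    by_cases hx : ‖x‖ ≤ 1
    · rw [indicator_of_mem (by simpa using hx)]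
      have h1 : heatDensity ν t x ≤ M := heatDensity_le_zero_value hν hHW ht x
      have h2 : 0 ≤ |c * t| * (min (‖x‖ ^ 2) 1 * ν x) := by positivity
      linarith
    · rw [indicator_of_notMem (by simpa using hx), zero_add]
      push Not at hx
      have hx0 : x ≠ 0 := by
        rintro rfl
        simp at hx
        linarith
      rw [min_eq_right (by nlinarith), one_mul]
      refine (hc x hx0).trans ?_
      exact mul_le_mul_of_nonneg_right (le_abs_self _) (hν.pos x hx0).le

/-- Fourier inversion, available because e^{-tψ} is continuous and both it and the density are
integrable. -/
lemma integral_cos_mul_heatDensity (hν : IsLevyDensity ν) (hHW : HartmanWintner ν)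
    {t : ℝ} (ht : 0 < t) (hk : Integrable (heatDensity ν t)) (ξ : Rd d) :
    ∫ x, Real.cos (inner ℝ ξ x) * heatDensity ν t x = Real.exp (-(t * levyExponent ν ξ)) := by
  have hI := integrable_exp_neg_levyExponent hν hHW ht
  have hpi : (0 : ℝ) < 2 * Real.pi := by positivity
  set f : Rd d → ℂ := fun ξ => ((Real.exp (-(t * levyExponent ν ξ)) : ℝ) : ℂ) with hf
  have hfI : Integrable f := hI.ofReal
  have hfc : Continuous f := by
    have := continuous_levyExponent hν
    fun_prop
  -- The transform `𝓕` has 2π in the exponent, hence the dilation; the factor (2π)^d is later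
  -- absorbed by the change of variables in `h3`.
  have hF : 𝓕 f = fun w => (((2 * Real.pi) ^ d * heatDensity ν t ((2 * Real.pi) • w) : ℝ) : ℂ) := by
    ext w
    rw [heatDensity_eq hν hHW ht, mul_inv_cancel_left₀ (by positivity), Real.fourier_eq']
    have e : ∀ v : Rd d, Complex.exp (((-2 * Real.pi * inner ℝ v w : ℝ) : ℂ) * Complex.I) • f v
        = ((Real.cos (inner ℝ v ((2 * Real.pi) • w)) * Real.exp (-(t * levyExponent ν v)) : ℝ) : ℂ)
        - ((Real.sin (inner ℝ ((2 * Real.pi) • w) v) *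
            Real.exp (-(t * levyExponent ν v)) : ℝ) : ℂ) * Complex.I := by
      intro v
      rw [Complex.exp_mul_I, ← Complex.ofReal_cos, ← Complex.ofReal_sin,
        real_inner_comm v ((2 * Real.pi) • w),
        inner_smul_right,
        show -2 * Real.pi * inner ℝ v w = -(2 * Real.pi * inner ℝ v w) by ring, Real.cos_neg,
        Real.sin_neg]
      simp only [hf, smul_eq_mul]
      push_cast
      ring
    simp_rw [e]
    rw [integral_sub (Integrable.cos_inner_mul hI _).ofReal
      ((Integrable.sin_inner_mul' hI _).ofReal.mul_const _), integral_mul_const,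
      integral_complex_ofReal, integral_complex_ofReal, integral_sin_mul_eq_zero (fun z => by rw [levyExponent_neg])]
    simp
  have hFI : Integrable (𝓕 f) := by
    rw [hF]
    exact ((hk.comp_smul hpi.ne').const_mul _).ofReal
  have hinv := congrFun (hfc.fourierInv_fourier_eq hfI hFI) ξ
  rw [Real.fourierInv_eq', hF] at hinv
  have hre := congrArg Complex.re hinv
  have hCI : Integrable fun v : Rd d =>
      Complex.exp (((2 * Real.pi * inner ℝ v ξ : ℝ) : ℂ) * Complex.I) •
      (((2 * Real.pi) ^ d * heatDensity ν t ((2 * Real.pi) • v) : ℝ) : ℂ) := by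
    simp only [smul_eq_mul]
    refine Integrable.bdd_mul (c := 1) (by rw [hF] at hFI; exact hFI)
      (by fun_prop) (Eventually.of_forall fun v => ?_)
    rw [Complex.norm_exp_ofReal_mul_I]
  rw [show ∀ z : ℂ, z.re = RCLike.re z from fun _ => rfl, ← integral_re hCI] at hre
  simp only [RCLike.re_to_complex, smul_eq_mul, Complex.re_mul_ofReal, Complex.exp_ofReal_mul_I_re,
    hf, Complex.ofReal_re] at hre
  rw [← hre]
  have h3 := Measure.integral_comp_smul (volume : Measure (Rd d))
    (fun x => Real.cos (inner ℝ ξ x) * heatDensity ν t x) (2 * Real.pi)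
  simp only [finrank_euclideanSpace, Fintype.card_fin, smul_eq_mul] at h3
  rw [abs_of_pos (by positivity), eq_inv_mul_iff_mul_eq₀ (by positivity), ← integral_const_mul]
    at h3
  rw [← h3]
  congr 1; ext v
  rw [inner_smul_right, real_inner_comm]
  ring

/-- The properties of the convolution semigroup of densities `k` with jump density `ν` on which
the Hardy–Stein identity rests. -/
structure IsHeatKernel (ν : Rd d → ℝ) (k : ℝ → Rd d → ℝ) : Prop where
  ae_ne : ∀ a : Rd d, ∀ᵐ x : Rd d, x ≠ a
  levy : IsLevyDensity ν
  measurable : Measurable (Function.uncurry k)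
  nonneg : ∀ t, 0 < t → ∀ x, 0 ≤ k t x
  neg : ∀ t, 0 < t → ∀ x, k t (-x) = k t x
  integrable : ∀ t, 0 < t → Integrable (k t)
  integral_eq_one : ∀ t, 0 < t → ∫ x, k t x = 1
  convolution : ∀ s t, 0 < s → 0 < t → ∀ x, ∫ y, k s y * k t (x - y) = k (s + t) x
  continuousOn : ∀ x, ContinuousOn (fun t => k t x) (Ioi 0)
  sup_bound : ∃ M : ℝ → ℝ, AntitoneOn M (Ioi 0) ∧ Tendsto M atTop (𝓝 0) ∧
    ∀ t, 0 < t → ∀ x, k t x ≤ M t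
  relative_bound : ∃ c, 0 ≤ c ∧ ∀ t, 0 < t → ∀ x, x ≠ 0 → k t x ≤ c * t * ν x
  small_time : ∀ x, x ≠ 0 → Tendsto (fun t => k t x / t) (𝓝[>] 0) (𝓝 (ν x))

theorem isHeatKernel_heatDensity (hd : 1 ≤ d) (hν : IsLevyDensity ν) (hHW : HartmanWintner ν)
    (hP1 : RelativeUpperBound ν) (hP2 : SmallTimeLimit ν) : IsHeatKernel ν (heatDensity ν) := by
  have : Nonempty (Fin d) := ⟨⟨0, hd⟩⟩
  obtain ⟨c, hc⟩ := hP1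
  have hc' : ∀ t, 0 < t → ∀ x : Rd d, x ≠ 0 → heatDensity ν t x ≤ c * t * ν x := by
    intro t ht x hx
    have := hc t ht 0 x hx.symm
    simp only [heatKernel, jumpKernel, sub_zero, div_le_iff₀ ht] at this
    linarith
  have hint : ∀ t, 0 < t → Integrable (heatDensity ν t) := fun t ht =>
    integrable_heatDensity hd hν hHW ht (hc' t ht)
  have hcos := fun t ht => integral_cos_mul_heatDensity hν hHW (t := t) ht (hint t ht)
  refine ⟨fun a => compl_mem_ae_iff.mpr (measure_singleton a), hν, measurable_heatDensity hν,
    fun t ht x => heatDensity_nonneg hν hHW ht x, fun t ht x => heatDensity_neg hν hHW ht x,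
    hint, fun t ht => ?_, fun s t hs ht x => ?_, continuousOn_heatDensity hν hHW,
    ⟨fun t => ((2 * Real.pi) ^ d)⁻¹ * ∫ ξ : Rd d, Real.exp (-(t * levyExponent ν ξ)), ?_, ?_,
      fun t ht x => heatDensity_le_zero_value hν hHW ht x⟩,
    ⟨|c|, abs_nonneg c, fun t ht x hx => (hc' t ht x hx).trans ?_⟩, fun x hx => ?_⟩
  · have := hcos t ht 0
    simpa [levyExponent] using this
  -- On the transform side the convolution law is e^{-sψ} e^{-tψ} = e^{-(s+t)ψ}.
  · have h1 := integral_cos_mul_cosTransform (integrable_exp_neg_levyExponent hν hHW ht)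
      (hint s hs) (heatDensity_neg hν hHW hs) x
    simp_rw [hcos s hs, ← Real.exp_add] at h1
    rw [heatDensity_eq hν hHW (add_pos hs ht)]
    simp_rw [heatDensity_eq hν hHW ht]
    have e : ∀ y, heatDensity ν s y * (((2 * Real.pi) ^ d)⁻¹ *
        ∫ ξ : Rd d, Real.cos (inner ℝ ξ (x - y)) * Real.exp (-(t * levyExponent ν ξ)))
        = ((2 * Real.pi) ^ d)⁻¹ * (heatDensity ν s y *
        ∫ ξ : Rd d, Real.cos (inner ℝ ξ (x - y)) * Real.exp (-(t * levyExponent ν ξ))) :=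
      fun y => by ring
    simp_rw [e]
    rw [integral_const_mul, ← h1]
    congr 2; ext ξ
    congr 2; ring
  · intro s hs t ht hst
    simp only
    refine mul_le_mul_of_nonneg_left (integral_mono (integrable_exp_neg_levyExponent hν hHW ht)
      (integrable_exp_neg_levyExponent hν hHW hs) fun ξ => ?_) (by positivity)
    simp only [Real.exp_le_exp, neg_le_neg_iff]
    exact mul_le_mul_of_nonneg_right hst (levyExponent_nonneg hν ξ)
  · simpa using (tendsto_integral_exp_neg_levyExponent hd hν hHW).const_mul ((2 * Real.pi) ^ d)⁻¹
  · have := (hν.pos x hx).le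
    gcongr
    exact le_abs_self c
  · simpa [heatKernel, jumpKernel] using hP2 0 x hx.symm

end HardyStein

/-! ### Convex powers, convex potentials and Bregman divergences -/

namespace HardyStein

/-- Bernoulli's inequality for `a / b`, multiplied by `b ^ r`. -/
lemma rpow_tangent {a b r : ℝ} (ha : 0 ≤ a) (hb : 0 ≤ b) (hr : 1 ≤ r) :
    b ^ r + r * b ^ (r - 1) * (a - b) ≤ a ^ r := by
  rcases hb.eq_or_lt with rfl | hb
  · rcases hr.eq_or_lt with rfl | hr
    · simp
    · rw [Real.zero_rpow (by linarith), Real.zero_rpow (by linarith)]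
      simpa using Real.rpow_nonneg ha r
  · have h := one_add_mul_self_le_rpow_one_add (s := a / b - 1)
      (by linarith [div_nonneg ha hb.le]) hr
    have hbr : 0 < b ^ r := Real.rpow_pos_of_pos hb r
    rw [show 1 + (a / b - 1) = a / b by ring, Real.div_rpow ha hb.le, le_div_iff₀ hbr] at h
    have e : b ^ (r - 1) = b ^ r / b := by rw [Real.rpow_sub_one hb.ne']
    rw [e]
    refine le_trans (le_of_eq ?_) h
    field_simp

/-- `κ` is convex with continuous subgradient `κ'`, and is dominated by the power `p - 1`. -/
structure IsConvexPower (p : ℝ) (κ κ' : ℝ → ℝ) : Prop where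
  continuous : Continuous κ
  continuous_deriv : Continuous κ'
  abs_le : ∀ s, |κ s| ≤ |s| ^ (p - 1)
  abs_deriv_le : ∀ s, |κ' s| ≤ (p - 1) * |s| ^ (p - 2)
  tangent : ∀ w z, κ w + κ' w * (z - w) ≤ κ z

/-- At p = 2 the second function would be identically 1, since 0^0 = 1, and would not be a
subgradient on the negative axis; hence the strict inequality. -/
lemma isConvexPower_max {p : ℝ} (hp : 2 < p) :
    IsConvexPower p (fun s => max s 0 ^ (p - 1)) (fun s => (p - 1) * max s 0 ^ (p - 2)) := by
  have hle : ∀ s : ℝ, max s 0 ≤ |s| := fun s => max_le (le_abs_self s) (abs_nonneg s)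
  refine ⟨?_, ?_, fun s => ?_, fun s => ?_, fun w z => ?_⟩
  · exact (continuous_id.max continuous_const).rpow_const fun s => Or.inr (by linarith)
  · exact continuous_const.mul
      ((continuous_id.max continuous_const).rpow_const fun s => Or.inr (by linarith))
  · rw [abs_of_nonneg (by positivity)]
    exact Real.rpow_le_rpow (le_max_right _ _) (hle s) (by linarith)
  · have h1 : 0 ≤ p - 1 := by linarith
    rw [abs_of_nonneg (by positivity)]
    exact mul_le_mul_of_nonneg_left
      (Real.rpow_le_rpow (le_max_right _ _) (hle s) (by linarith)) h1
  · refine le_trans ?_ (rpow_tangent (le_max_right z 0) (le_max_right w 0)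
      (by linarith : 1 ≤ p - 1))
    rw [show p - 1 - 1 = p - 2 by ring]
    rcases le_total w 0 with hw | hw
    · rw [max_eq_right hw, Real.zero_rpow (by linarith : p - 2 ≠ 0)]
      simp
    · rw [max_eq_left hw]
      have h1 : 0 ≤ p - 1 := by linarith
      gcongr
      exact le_max_left _ _

lemma IsConvexPower.comp_neg {p : ℝ} {κ κ' : ℝ → ℝ} (h : IsConvexPower p κ κ') :
    IsConvexPower p (fun s => κ (-s)) (fun s => -κ' (-s)) := by
  refine ⟨h.continuous.comp continuous_neg, (h.continuous_deriv.comp continuous_neg).neg,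
    fun s => ?_, fun s => ?_, fun w z => ?_⟩
  · simpa using h.abs_le (-s)
  · simpa using h.abs_deriv_le (-s)
  · have := h.tangent (-w) (-z)
    linarith

/-- The signed power is a difference of two convex powers. -/
lemma exists_isConvexPower_sub {p : ℝ} (hp : 2 ≤ p) : ∃ κ κ' μ μ' : ℝ → ℝ,
    IsConvexPower p κ κ' ∧ IsConvexPower p μ μ' ∧
    (∀ s, signedPow s (p - 1) = κ s - μ s) ∧ ∀ s, (p - 1) * |s| ^ (p - 2) = κ' s - μ' s := by
  rcases hp.eq_or_lt with rfl | hp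
  -- For p = 2 the signed power is the identity, already convex, so the subtracted part is zero.
  · have e : (2 : ℝ) - 1 = 1 := by norm_num
    refine ⟨fun s => s, fun _ => 1, fun _ => 0, fun _ => 0, ⟨by fun_prop, by fun_prop, ?_, ?_, ?_⟩,
      ⟨by fun_prop, by fun_prop, ?_, ?_, ?_⟩, fun s => ?_, fun s => ?_⟩
    · simp [e]
    · simp [e]
    · intro w z; simp
    · simp [e]
    · simp [e]
    · intro w z; simp
    · rw [signedPow, e, Real.rpow_one]
      rcases lt_trichotomy s 0 with h | rfl | h
      · simp [Real.sign_of_neg h, abs_of_neg h]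
      · simp
      · simp [Real.sign_of_pos h, abs_of_pos h]
    · simp [e]
  · refine ⟨_, _, _, _, isConvexPower_max hp, (isConvexPower_max hp).comp_neg, fun s => ?_,
      fun s => ?_⟩
    · rw [signedPow]
      rcases lt_trichotomy s 0 with h | rfl | h
      · rw [Real.sign_of_neg h, abs_of_neg h, max_eq_right h.le, max_eq_left (by linarith),
          Real.zero_rpow (by linarith)]
        ring
      · simp
      · rw [Real.sign_of_pos h, abs_of_pos h, max_eq_left h.le, max_eq_right (by linarith),
          Real.zero_rpow (by linarith)]
        ring
    · rcases le_total s 0 with h | h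
      · rw [abs_of_nonpos h, max_eq_right h, max_eq_left (by linarith),
          Real.zero_rpow (by linarith)]
        ring
      · rw [abs_of_nonneg h, max_eq_left h, max_eq_right (by linarith),
          Real.zero_rpow (by linarith)]
        ring

/-- Euclidean norm of a pair. -/
noncomputable def pairNorm (w : ℝ × ℝ) : ℝ := √(w.1 ^ 2 + w.2 ^ 2)

lemma pairNorm_nonneg (w : ℝ × ℝ) : 0 ≤ pairNorm w := Real.sqrt_nonneg _

lemma pairNorm_sq (w : ℝ × ℝ) : pairNorm w ^ 2 = w.1 ^ 2 + w.2 ^ 2 :=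
  Real.sq_sqrt (by positivity)

lemma abs_fst_le_pairNorm (w : ℝ × ℝ) : |w.1| ≤ pairNorm w :=
  Real.abs_le_sqrt (by nlinarith [sq_nonneg w.2])

lemma abs_snd_le_pairNorm (w : ℝ × ℝ) : |w.2| ≤ pairNorm w :=
  Real.abs_le_sqrt (by nlinarith [sq_nonneg w.1])

lemma pairNorm_le (w : ℝ × ℝ) : pairNorm w ≤ 2 * ‖w‖ := by
  refine Real.sqrt_le_iff.mpr ⟨by positivity, ?_⟩
  have h1 : |w.1| ≤ ‖w‖ := norm_fst_le w
  have h2 : |w.2| ≤ ‖w‖ := norm_snd_le w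
  rw [← sq_abs w.1, ← sq_abs w.2]
  nlinarith [abs_nonneg w.1, abs_nonneg w.2, norm_nonneg w]

lemma continuous_pairNorm : Continuous pairNorm := by
  unfold pairNorm
  fun_prop

/-- The tangent inequality for the power p/2, taken at |w|² and |z|², with |z|² - |w|² = 2 w·(z-w) +
|z-w|². The quadratic term is kept: it pays for the lack of convexity of w₁ κ(w₂). -/
lemma pairNorm_rpow_tangent {p : ℝ} (hp : 2 ≤ p) (w z : ℝ × ℝ) :
    pairNorm w ^ p + p * pairNorm w ^ (p - 2) * (w.1 * (z.1 - w.1) + w.2 * (z.2 - w.2))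
      + p / 2 * pairNorm w ^ (p - 2) * ((z.1 - w.1) ^ 2 + (z.2 - w.2) ^ 2) ≤ pairNorm z ^ p := by
  have h := rpow_tangent (sq_nonneg (pairNorm z)) (sq_nonneg (pairNorm w))
    (by linarith : 1 ≤ p / 2)
  have e : ∀ (v : ℝ × ℝ) (r : ℝ), (pairNorm v ^ 2) ^ r = pairNorm v ^ (2 * r) := by
    intro v r
    rw [← Real.rpow_natCast, ← Real.rpow_mul (pairNorm_nonneg v)]
    norm_num
  rw [e, e, e, pairNorm_sq, pairNorm_sq, show 2 * (p / 2) = p by ring,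
    show 2 * (p / 2 - 1) = p - 2 by ring] at h
  refine le_trans (le_of_eq ?_) h
  ring

/-- A potential `Y` of growth `p` on the plane, with continuous gradient field `(Y₁, Y₂)`, which is
nonnegative and convex on the half-plane `w₁ ≥ 0`. -/
structure IsConvexPotential (p : ℝ) (Y Y₁ Y₂ : ℝ × ℝ → ℝ) : Prop where
  continuous : Continuous Y
  continuous_fst : Continuous Y₁
  continuous_snd : Continuous Y₂
  bound : ∃ C, 0 ≤ C ∧ (∀ w, |Y w| ≤ C * ‖w‖ ^ p) ∧ (∀ w, |Y₁ w| ≤ C * ‖w‖ ^ (p - 1)) ∧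
    ∀ w, |Y₂ w| ≤ C * ‖w‖ ^ (p - 1)
  nonneg : ∀ w, 0 ≤ w.1 → 0 ≤ Y w
  tangent : ∀ w z, 0 ≤ w.1 → 0 ≤ z.1 →
    Y w + Y₁ w * (z.1 - w.1) + Y₂ w * (z.2 - w.2) ≤ Y z

/-- The potential `w₁ κ(w₂) + |w|^p`. -/
noncomputable def potential (p : ℝ) (κ : ℝ → ℝ) (w : ℝ × ℝ) : ℝ := w.1 * κ w.2 + pairNorm w ^ p

/-- The first partial derivative of `potential`. -/
noncomputable def potentialFst (p : ℝ) (κ : ℝ → ℝ) (w : ℝ × ℝ) : ℝ := κ w.2 + p * pairNorm w ^ (p - 2) * w.1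

/-- The second partial derivative of `potential`. -/
noncomputable def potentialSnd (p : ℝ) (κ' : ℝ → ℝ) (w : ℝ × ℝ) : ℝ :=
  w.1 * κ' w.2 + p * pairNorm w ^ (p - 2) * w.2

lemma rpow_mul_self {a r : ℝ} (ha : 0 ≤ a) (hr : 0 ≤ r) : a ^ r * a = a ^ (r + 1) := by
  rw [Real.rpow_add' ha (by linarith), Real.rpow_one]

/-- Multiplying the tangent inequality of `κ` by z₁ ≥ 0 gives the one for w₁ κ(w₂) up to the error
(z₁-w₁) κ'(w₂) (z₂-w₂). As |κ'(w₂)| ≤ (p-1)|w|^{p-2}, this error is at most the quadratic gain p/2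
|w|^{p-2} |z-w|² from |w|^p. -/
lemma IsConvexPower.isConvexPotential {p : ℝ} (hp : 2 ≤ p) {κ κ' : ℝ → ℝ}
    (h : IsConvexPower p κ κ') :
    IsConvexPotential p (potential p κ) (potentialFst p κ) (potentialSnd p κ') := by
  have hκ := h.continuous
  have hκ' := h.continuous_deriv
  have hN := continuous_pairNorm
  have hNp : ∀ r : ℝ, 0 ≤ r → Continuous fun w => pairNorm w ^ r := fun r hr =>
    hN.rpow_const fun w => Or.inr hr
  have hNp0 := hNp p (by linarith)
  have hNp2 := hNp (p - 2) (by linarith)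
  have hκN : ∀ w : ℝ × ℝ, |κ w.2| ≤ pairNorm w ^ (p - 1) := fun w => (h.abs_le _).trans
    (Real.rpow_le_rpow (abs_nonneg _) (abs_snd_le_pairNorm w) (by linarith))
  have hκN' : ∀ w : ℝ × ℝ, |κ' w.2| ≤ (p - 1) * pairNorm w ^ (p - 2) := fun w =>
    (h.abs_deriv_le _).trans (mul_le_mul_of_nonneg_left
      (Real.rpow_le_rpow (abs_nonneg _) (abs_snd_le_pairNorm w) (by linarith)) (by linarith))
  have hwκ : ∀ w : ℝ × ℝ, |w.1 * κ w.2| ≤ pairNorm w ^ p := by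
    intro w
    rw [abs_mul, show p = p - 1 + 1 by ring, ← rpow_mul_self (pairNorm_nonneg w) (by linarith),
      mul_comm]
    exact mul_le_mul (hκN w) (abs_fst_le_pairNorm w) (abs_nonneg _)
      (Real.rpow_nonneg (pairNorm_nonneg w) _)
  have hstep : ∀ w : ℝ × ℝ, pairNorm w ^ (p - 2) * pairNorm w = pairNorm w ^ (p - 1) := by
    intro w
    rw [rpow_mul_self (pairNorm_nonneg w) (by linarith)]
    congr 1; ring
  have hle : ∀ (w : ℝ × ℝ) (r : ℝ), 0 ≤ r → pairNorm w ^ r ≤ 2 ^ r * ‖w‖ ^ r := by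
    intro w r hr
    rw [← Real.mul_rpow (by norm_num) (norm_nonneg w)]
    exact Real.rpow_le_rpow (pairNorm_nonneg w) (pairNorm_le w) hr
  have h2p : (2 : ℝ) ^ (p - 1) ≤ 2 ^ p := Real.rpow_le_rpow_of_exponent_le (by norm_num)
    (by linarith)
  have hgrad : ∀ (w : ℝ × ℝ) (a : ℝ), |a| ≤ 2 * p * pairNorm w ^ (p - 1) →
      |a| ≤ 2 * p * 2 ^ p * ‖w‖ ^ (p - 1) := by
    intro w a ha
    refine ha.trans ?_
    rw [mul_assoc (2 * p)]
    refine mul_le_mul_of_nonneg_left ((hle w (p - 1) (by linarith)).trans ?_) (by linarith)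
    gcongr
  refine ⟨?_, ?_, ?_, ⟨2 * p * 2 ^ p, by positivity, fun w => ?_, fun w => ?_, fun w => ?_⟩,
    fun w hw => ?_, fun w z hw hz => ?_⟩
  · unfold potential; fun_prop
  · unfold potentialFst; fun_prop
  · unfold potentialSnd; fun_prop
  · have h0 := Real.rpow_nonneg (pairNorm_nonneg w) p
    have h3 : 0 ≤ (2 : ℝ) ^ p * ‖w‖ ^ p := by positivity
    calc |potential p κ w| ≤ |w.1 * κ w.2| + |pairNorm w ^ p| := abs_add_le _ _
      _ ≤ pairNorm w ^ p + pairNorm w ^ p := by rw [abs_of_nonneg h0]; gcongr; exact hwκ w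
      _ ≤ 2 ^ p * ‖w‖ ^ p + 2 ^ p * ‖w‖ ^ p := by
          gcongr <;> exact hle w p (by linarith)
      _ ≤ 2 * p * 2 ^ p * ‖w‖ ^ p := by nlinarith
  · refine hgrad w _ ?_
    have h0 := Real.rpow_nonneg (pairNorm_nonneg w) (p - 2)
    have h1 := Real.rpow_nonneg (pairNorm_nonneg w) (p - 1)
    calc |potentialFst p κ w| ≤ |κ w.2| + |p * pairNorm w ^ (p - 2) * w.1| := abs_add_le _ _
      _ ≤ pairNorm w ^ (p - 1) + p * pairNorm w ^ (p - 2) * pairNorm w := by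
          rw [abs_mul, abs_of_nonneg (a := p * pairNorm w ^ (p - 2)) (by positivity)]
          gcongr
          · exact hκN w
          · exact abs_fst_le_pairNorm w
      _ = (1 + p) * pairNorm w ^ (p - 1) := by rw [mul_assoc, hstep]; ring
      _ ≤ _ := by gcongr; linarith
  · refine hgrad w _ ?_
    have h0 := Real.rpow_nonneg (pairNorm_nonneg w) (p - 2)
    have h1 := Real.rpow_nonneg (pairNorm_nonneg w) (p - 1)
    calc |potentialSnd p κ' w| ≤ |w.1 * κ' w.2| + |p * pairNorm w ^ (p - 2) * w.2| :=
          abs_add_le _ _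
      _ ≤ pairNorm w * ((p - 1) * pairNorm w ^ (p - 2))
          + p * pairNorm w ^ (p - 2) * pairNorm w := by
          rw [abs_mul, abs_mul, abs_of_nonneg (a := p * pairNorm w ^ (p - 2)) (by positivity)]
          have := pairNorm_nonneg w
          gcongr
          · exact abs_fst_le_pairNorm w
          · exact hκN' w
          · exact abs_snd_le_pairNorm w
      _ = (2 * p - 1) * pairNorm w ^ (p - 1) := by rw [← hstep]; ring
      _ ≤ _ := by gcongr; linarith
  · have := (_root_.abs_le.mp (hwκ w)).1
    unfold potential
    linarith
  · have h1 := pairNorm_rpow_tangent hp w z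
    have h2 := mul_le_mul_of_nonneg_left (h.tangent w.2 z.2) hz
    have h3 := hκN' w
    have h0 := Real.rpow_nonneg (pairNorm_nonneg w) (p - 2)
    have h4 : -((z.1 - w.1) * κ' w.2 * (z.2 - w.2)) ≤
        p / 2 * pairNorm w ^ (p - 2) * ((z.1 - w.1) ^ 2 + (z.2 - w.2) ^ 2) := by
      have h5 : |(z.1 - w.1) * (z.2 - w.2)| ≤ ((z.1 - w.1) ^ 2 + (z.2 - w.2) ^ 2) / 2 := by
        rw [abs_mul, ← sq_abs (z.1 - w.1), ← sq_abs (z.2 - w.2)]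
        nlinarith [sq_nonneg (|z.1 - w.1| - |z.2 - w.2|)]
      calc _ ≤ |(z.1 - w.1) * κ' w.2 * (z.2 - w.2)| := neg_le_abs _
        _ = |κ' w.2| * |(z.1 - w.1) * (z.2 - w.2)| := by rw [← abs_mul]; congr 1; ring
        _ ≤ ((p - 1) * pairNorm w ^ (p - 2)) * (((z.1 - w.1) ^ 2 + (z.2 - w.2) ^ 2) / 2) := by
            have : 0 ≤ p - 1 := by linarith
            gcongr
        _ ≤ (p * pairNorm w ^ (p - 2)) * (((z.1 - w.1) ^ 2 + (z.2 - w.2) ^ 2) / 2) := by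
            gcongr; linarith
        _ = _ := by ring
    unfold potential potentialFst potentialSnd
    nlinarith

/-- The Bregman divergence of `Y` for the gradient field `(Y₁, Y₂)`. -/
noncomputable def bregman (Y Y₁ Y₂ : ℝ × ℝ → ℝ) (w z : ℝ × ℝ) : ℝ :=
  Y z - Y w - Y₁ w * (z.1 - w.1) - Y₂ w * (z.2 - w.2)

lemma IsConvexPotential.bregman_nonneg {p : ℝ} {Y Y₁ Y₂ : ℝ × ℝ → ℝ}
    (h : IsConvexPotential p Y Y₁ Y₂) {w z : ℝ × ℝ} (hw : 0 ≤ w.1) (hz : 0 ≤ z.1) :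
    0 ≤ bregman Y Y₁ Y₂ w z := by
  have := h.tangent w z hw hz
  unfold bregman
  linarith

lemma IsConvexPotential.continuous_bregman {p : ℝ} {Y Y₁ Y₂ : ℝ × ℝ → ℝ}
    (h : IsConvexPotential p Y Y₁ Y₂) :
    Continuous fun q : (ℝ × ℝ) × (ℝ × ℝ) => bregman Y Y₁ Y₂ q.1 q.2 := by
  have h1 := h.continuous
  have h2 := h.continuous_fst
  have h3 := h.continuous_snd
  unfold bregman
  fun_prop

/-- The term |w|^p, present only for convexity, is common to both potentials and cancels. -/
lemma bregmanCoDivergence_eq_sub {p : ℝ} {κ κ' μ μ' : ℝ → ℝ}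
    (h : ∀ s, signedPow s (p - 1) = κ s - μ s)
    (h' : ∀ s, (p - 1) * |s| ^ (p - 2) = κ' s - μ' s) (w z : ℝ × ℝ) :
    bregmanCoDivergence p w z =
      bregman (potential p κ) (potentialFst p κ) (potentialSnd p κ') w z -
      bregman (potential p μ) (potentialFst p μ) (potentialSnd p μ') w z := by
  have e : (p - 1) * w.1 * |w.2| ^ (p - 2) = w.1 * (κ' w.2 - μ' w.2) := by rw [← h']; ring
  unfold bregmanCoDivergence bregman potential potentialFst potentialSnd
  rw [e, h, h]
  ring

end HardyStein

/-! ### The semigroup on L^p -/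

namespace HardyStein

variable {d : ℕ}

/-- A measurable function whose `p`-th power is integrable. -/
structure PowIntegrable (p : ℝ) (f : Rd d → ℝ) : Prop where
  measurable : Measurable f
  integrable : Integrable fun x => |f x| ^ p

/-- The action of the kernel `k t (y - x)` for `t > 0`, and the identity for `t ≤ 0`. -/
noncomputable def evolve (k : ℝ → Rd d → ℝ) (t : ℝ) (f : Rd d → ℝ) (x : Rd d) : ℝ :=
  if 0 < t then ∫ y, f y * k t (y - x) else f x

lemma evolve_of_pos {k : ℝ → Rd d → ℝ} {t : ℝ} (ht : 0 < t) (f : Rd d → ℝ) (x : Rd d) :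
    evolve k t f x = ∫ y, f y * k t (y - x) := if_pos ht

lemma evolve_zero (k : ℝ → Rd d → ℝ) (f : Rd d → ℝ) : evolve k 0 f = f := by
  ext x
  simp [evolve]

lemma abs_add_rpow_le {p : ℝ} (hp : 0 ≤ p) (a b : ℝ) :
    |a + b| ^ p ≤ 2 ^ p * (|a| ^ p + |b| ^ p) := by
  have h : |a + b| ≤ 2 * max |a| |b| :=
    (abs_add_le a b).trans (by linarith [le_max_left |a| |b|, le_max_right |a| |b|])
  refine (Real.rpow_le_rpow (abs_nonneg _) h hp).trans ?_
  rw [Real.mul_rpow (by norm_num) (by positivity)]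
  gcongr
  rcases max_choice |a| |b| with h | h <;> rw [h]
  · linarith [Real.rpow_nonneg (abs_nonneg b) p]
  · linarith [Real.rpow_nonneg (abs_nonneg a) p]

lemma abs_sub_rpow_le {p : ℝ} (hp : 0 ≤ p) (a b : ℝ) :
    |a - b| ^ p ≤ 2 ^ p * (|a| ^ p + |b| ^ p) := by
  simpa [sub_eq_add_neg] using abs_add_rpow_le hp a (-b)

lemma le_rpow_add_one {p a : ℝ} (hp : 1 ≤ p) (ha : 0 ≤ a) : a ≤ a ^ p + 1 := by
  rcases le_total a 1 with h | h
  · linarith [Real.rpow_nonneg ha p]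
  · have := Real.self_le_rpow_of_one_le h hp
    linarith

namespace PowIntegrable

variable {p : ℝ} {f g : Rd d → ℝ}

lemma add (hp : 0 ≤ p) (hf : PowIntegrable p f) (hg : PowIntegrable p g) :
    PowIntegrable p fun x => f x + g x := by
  have hm := hf.measurable
  have hm' := hg.measurable
  refine ⟨by fun_prop, ((hf.integrable.add hg.integrable).const_mul (2 ^ p)).mono'
    (by fun_prop) (Eventually.of_forall fun x => ?_)⟩
  rw [Real.norm_eq_abs, abs_of_nonneg (by positivity)]
  exact abs_add_rpow_le hp _ _

lemma neg (hf : PowIntegrable p f) : PowIntegrable p fun x => -f x :=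
  ⟨hf.measurable.neg, by simpa using hf.integrable⟩

lemma sub (hp : 0 ≤ p) (hf : PowIntegrable p f) (hg : PowIntegrable p g) :
    PowIntegrable p fun x => f x - g x := by
  simpa [sub_eq_add_neg] using hf.add hp hg.neg

lemma posPart (hp : 0 ≤ p) (hf : PowIntegrable p f) : PowIntegrable p fun x => max (f x) 0 := by
  have hm := hf.measurable
  refine ⟨by fun_prop, hf.integrable.mono' (by fun_prop) (Eventually.of_forall fun x => ?_)⟩
  rw [Real.norm_eq_abs, abs_of_nonneg (by positivity)]
  refine Real.rpow_le_rpow (abs_nonneg _) ?_ hp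
  rw [abs_of_nonneg (le_max_right _ _)]
  exact max_le (le_abs_self _) (abs_nonneg _)

lemma memLp (hp : 0 < p) (hf : PowIntegrable p f) : MemLp f (ENNReal.ofReal p) := by
  rw [← integrable_norm_rpow_iff hf.measurable.aestronglyMeasurable (by simpa using hp)
    ENNReal.ofReal_ne_top, ENNReal.toReal_ofReal hp.le]
  exact hf.integrable

lemma of_memLp (hp : 0 < p) (hm : Measurable f) (hf : MemLp f (ENNReal.ofReal p)) :
    PowIntegrable p f := by
  refine ⟨hm, ?_⟩
  have := hf.integrable_norm_rpow (by simpa using hp) ENNReal.ofReal_ne_top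
  rwa [ENNReal.toReal_ofReal hp.le] at this

/-- Pairing with a bounded integrable kernel. -/
lemma integrable_mul (hp : 1 ≤ p) (hf : PowIntegrable p f) {D : Rd d → ℝ} {M : ℝ}
    (hD : Integrable D) (hM : ∀ x, |D x| ≤ M) : Integrable fun x => f x * D x := by
  refine ((hf.integrable.mul_const M).add hD.abs).mono'
    (hf.measurable.aestronglyMeasurable.mul hD.aestronglyMeasurable)
    (Eventually.of_forall fun x => ?_)
  rw [norm_mul, Real.norm_eq_abs, Real.norm_eq_abs]
  have h1 := mul_le_mul_of_nonneg_right (le_rpow_add_one hp (abs_nonneg (f x))) (abs_nonneg (D x))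
  have h2 := mul_le_mul_of_nonneg_left (hM x) (Real.rpow_nonneg (abs_nonneg (f x)) p)
  calc _ ≤ _ := h1
    _ = |f x| ^ p * |D x| + |D x| := by ring
    _ ≤ |f x| ^ p * M + |D x| := by linarith

/-- Continuity of translations in the mean of order `p`. -/
lemma tendsto_integral_translation (hp : 1 ≤ p) (hf : PowIntegrable p f) :
    Tendsto (fun z : Rd d => ∫ x, |f (x - z) - f x| ^ p) (𝓝 0) (𝓝 0) := by
  have hp0 : 0 < p := by linarith
  have : Fact (1 ≤ ENNReal.ofReal p) := ⟨by simpa using hp⟩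
  have hL := hf.memLp hp0
  have hmp : ∀ z : Rd d, MeasurePreserving (fun x : Rd d => x - z) volume volume := fun z =>
    measurePreserving_sub_right volume z
  -- Translations form a continuous family of measure-preserving maps, so composing with them is
  -- continuous in L^p.
  set τ : C(Rd d, C(Rd d, Rd d)) := (ContinuousMap.mk (fun q : Rd d × Rd d => q.2 - q.1)
    (by fun_prop)).curry
  have hτ : Continuous τ := ContinuousMap.continuous _
  have h1 := Filter.Tendsto.compMeasurePreservingLp (μ := (volume : Measure (Rd d)))
    (ν := (volume : Measure (Rd d)))
    (tendsto_const_nhds (x := hL.toLp f) (f := 𝓝 (0 : Rd d))) (hτ.tendsto 0) hmp (hmp 0)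
    ENNReal.ofReal_ne_top
  have h2 := (h1.sub_const (hL.toLp f)).norm
  have e : ∀ z, ‖Lp.compMeasurePreserving (τ z) (hmp z) (hL.toLp f) - hL.toLp f‖
      = (∫ x, |f (x - z) - f x| ^ p) ^ p⁻¹ := by
    intro z
    have hLz : MemLp (fun x => f (x - z)) (ENNReal.ofReal p) volume :=
      hL.comp_measurePreserving (hmp z)
    change ‖hLz.toLp _ - hL.toLp f‖ = _
    rw [← MemLp.toLp_sub, Lp.norm_toLp,
      (hLz.sub hL).eLpNorm_eq_integral_rpow_norm (by simpa using hp0) ENNReal.ofReal_ne_top,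
      ENNReal.toReal_ofReal (by positivity), ENNReal.toReal_ofReal hp0.le]
    rfl
  have e0 : (∫ x : Rd d, |f (x - 0) - f x| ^ p) ^ p⁻¹ = 0 := by
    simp [Real.zero_rpow hp0.ne', Real.zero_rpow (inv_pos.mpr hp0).ne']
  simp_rw [e] at h2
  rw [e0] at h2
  have h3 := h2.rpow_const (p := p) (Or.inr hp0.le)
  rw [Real.zero_rpow hp0.ne'] at h3
  refine h3.congr fun z => ?_
  rw [← Real.rpow_mul (integral_nonneg fun x => by positivity), inv_mul_cancel₀ hp0.ne',
    Real.rpow_one]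

end PowIntegrable

/-- Jensen's inequality for powers and an integrable probability density. -/
lemma rpow_integral_mul_le {p : ℝ} (hp : 1 ≤ p) {φ w : Rd d → ℝ} (hφ : ∀ x, 0 ≤ φ x)
    (hw : ∀ x, 0 ≤ w x) (hwI : Integrable w) (hw1 : ∫ x, w x = 1)
    (h1 : Integrable fun x => φ x * w x) (h2 : Integrable fun x => φ x ^ p * w x) :
    (∫ x, φ x * w x) ^ p ≤ ∫ x, φ x ^ p * w x := by
  set A := ∫ x, φ x * w x
  have hA : 0 ≤ A := integral_nonneg fun x => mul_nonneg (hφ x) (hw x)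
  have hI : Integrable fun x => φ x * w x - A * w x := h1.sub (hwI.const_mul _)
  -- The tangent inequality at the mean `A` is integrated; its linear term integrates to zero.
  have h3 : ∫ x, (A ^ p * w x + p * A ^ (p - 1) * (φ x * w x - A * w x)) ≤
      ∫ x, φ x ^ p * w x := by
    refine integral_mono ((hwI.const_mul _).add (hI.const_mul _)) h2
      fun x => ?_
    have := mul_le_mul_of_nonneg_right (rpow_tangent (hφ x) hA hp) (hw x)
    simp only
    linarith
  rw [integral_add (hwI.const_mul _) (hI.const_mul _), integral_const_mul,
    integral_const_mul, integral_sub h1 (hwI.const_mul _), integral_const_mul, hw1] at h3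
  simpa [A] using h3

namespace IsHeatKernel

variable {ν : Rd d → ℝ} {k : ℝ → Rd d → ℝ} (h : IsHeatKernel ν k)

include h

lemma measurable_apply (t : ℝ) : Measurable (k t) :=
  h.measurable.comp measurable_prodMk_left

lemma exists_bound {t : ℝ} (ht : 0 < t) : ∃ M, ∀ x, |k t x| ≤ M := by
  obtain ⟨M, -, -, hM⟩ := h.sup_bound
  exact ⟨M t, fun x => by rw [abs_of_nonneg (h.nonneg t ht x)]; exact hM t ht x⟩

lemma integrable_sub {t : ℝ} (ht : 0 < t) (x : Rd d) : Integrable fun y => k t (y - x) :=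
  (h.integrable t ht).comp_sub_right x

lemma integral_sub_eq_one {t : ℝ} (ht : 0 < t) (x : Rd d) : ∫ y, k t (y - x) = 1 := by
  rw [integral_sub_right_eq_self (k t) x, h.integral_eq_one t ht]

lemma sub_comm {t : ℝ} (ht : 0 < t) (x y : Rd d) : k t (x - y) = k t (y - x) := by
  rw [← h.neg t ht, neg_sub]

lemma integrable_snd_mul {t : ℝ} (ht : 0 < t) {φ : Rd d → ℝ} (hφ : Integrable φ) :
    Integrable (fun q : Rd d × Rd d => φ q.2 * k t (q.2 - q.1)) (volume.prod volume) := by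
  have := Integrable.convolution_integrand (ContinuousLinearMap.mul ℝ ℝ) hφ (h.integrable t ht)
  refine this.congr (Eventually.of_forall fun q => ?_)
  simp [h.sub_comm ht q.1 q.2]

lemma integrable_fst_mul {t : ℝ} (ht : 0 < t) {φ : Rd d → ℝ} (hφ : Integrable φ) :
    Integrable (fun q : Rd d × Rd d => φ q.1 * k t (q.2 - q.1)) (volume.prod volume) := by
  refine (h.integrable_snd_mul ht hφ).swap.congr (Eventually.of_forall fun q => ?_)
  simp [h.sub_comm ht q.1 q.2]

lemma integral_fst_mul {t : ℝ} (ht : 0 < t) (φ : Rd d → ℝ) (x : Rd d) :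
    ∫ y, φ x * k t (y - x) = φ x := by
  rw [integral_const_mul, h.integral_sub_eq_one ht, mul_one]

lemma integral_prod_snd_mul {t : ℝ} (ht : 0 < t) {φ : Rd d → ℝ} (hφ : Integrable φ) :
    ∫ q : Rd d × Rd d, φ q.2 * k t (q.2 - q.1) ∂(volume.prod volume) = ∫ x, φ x := by
  rw [integral_prod_symm _ (h.integrable_snd_mul ht hφ)]
  refine integral_congr_ae (Eventually.of_forall fun y => ?_)
  simp only
  simp_rw [h.sub_comm ht y]
  exact h.integral_fst_mul ht φ y

variable {p : ℝ} {f : Rd d → ℝ}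

lemma integrable_mul (hp : 1 ≤ p) (hf : PowIntegrable p f) {t : ℝ} (ht : 0 < t) (x : Rd d) :
    Integrable fun y => f y * k t (y - x) := by
  obtain ⟨M, hM⟩ := h.exists_bound ht
  exact hf.integrable_mul hp (h.integrable_sub ht x) (M := M) fun y => hM _

lemma integrable_rpow_mul (hf : PowIntegrable p f) {t : ℝ} (ht : 0 < t) (x : Rd d) :
    Integrable fun y => |f y| ^ p * k t (y - x) := by
  obtain ⟨M, hM⟩ := h.exists_bound ht
  exact hf.integrable.mul_bdd (c := M) (h.integrable_sub ht x).aestronglyMeasurable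
    (Eventually.of_forall fun y => hM _)

omit h in
lemma _root_.HardyStein.PowIntegrable.abs {p : ℝ} {f : Rd d → ℝ} (hf : PowIntegrable p f) :
    PowIntegrable p fun x => |f x| :=
  ⟨hf.measurable.abs, by simpa using hf.integrable⟩

lemma abs_evolve_le {t : ℝ} (ht : 0 < t) (f : Rd d → ℝ) (x : Rd d) :
    |evolve k t f x| ≤ ∫ y, |f y| * k t (y - x) := by
  rw [evolve_of_pos ht]
  refine (abs_integral_le_integral_abs).trans (le_of_eq ?_)
  congr 1; ext y
  rw [abs_mul, abs_of_nonneg (h.nonneg t ht _)]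

lemma abs_evolve_rpow_le (hp : 1 ≤ p) (hf : PowIntegrable p f) {t : ℝ} (ht : 0 < t) (x : Rd d) :
    |evolve k t f x| ^ p ≤ ∫ y, |f y| ^ p * k t (y - x) := by
  refine (Real.rpow_le_rpow (abs_nonneg _) (h.abs_evolve_le ht f x) (by linarith)).trans ?_
  exact rpow_integral_mul_le hp (fun y => abs_nonneg _) (fun y => h.nonneg t ht _)
    (h.integrable_sub ht x) (h.integral_sub_eq_one ht x) (h.integrable_mul hp hf.abs ht x)
    (h.integrable_rpow_mul hf ht x)

lemma measurable_uncurry_evolve (hf : Measurable f) :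
    Measurable fun q : ℝ × Rd d => evolve k q.1 f q.2 := by
  unfold evolve
  refine Measurable.ite (measurableSet_lt measurable_const measurable_fst) ?_
    (hf.comp measurable_snd)
  refine StronglyMeasurable.measurable ?_
  refine StronglyMeasurable.integral_prod_right
    (f := fun (q : ℝ × Rd d) (y : Rd d) => f y * k q.1 (y - q.2)) ?_
  refine Measurable.stronglyMeasurable ?_
  have h1 : Measurable fun r : (ℝ × Rd d) × Rd d => k r.1.1 (r.2 - r.1.2) :=
    h.measurable.comp (by fun_prop : Measurable fun r : (ℝ × Rd d) × Rd d => (r.1.1, r.2 - r.1.2))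
  exact (hf.comp measurable_snd).mul h1

lemma measurable_evolve (hf : Measurable f) (t : ℝ) : Measurable (evolve k t f) :=
  (h.measurable_uncurry_evolve hf).comp measurable_prodMk_left

lemma powIntegrable_evolve (hp : 1 ≤ p) (hf : PowIntegrable p f) (t : ℝ) :
    PowIntegrable p (evolve k t f) := by
  refine ⟨h.measurable_evolve hf.measurable t, ?_⟩
  by_cases ht : 0 < t
  · have hm := h.measurable_evolve hf.measurable t
    have hI := (h.integrable_snd_mul ht hf.integrable).integral_prod_left
    refine hI.mono' (hm.abs.pow_const p).aestronglyMeasurable (Eventually.of_forall fun x => ?_)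
    rw [Real.norm_eq_abs, abs_of_nonneg (by positivity)]
    exact h.abs_evolve_rpow_le hp hf ht x
  · simpa [evolve, ht] using hf.integrable

lemma integral_abs_evolve_rpow_le (hp : 1 ≤ p) (hf : PowIntegrable p f) {t : ℝ} (ht : 0 < t) :
    ∫ x, |evolve k t f x| ^ p ≤ ∫ x, |f x| ^ p := by
  have hI := h.integrable_snd_mul ht hf.integrable
  rw [← h.integral_prod_snd_mul ht hf.integrable, integral_prod _ hI]
  exact integral_mono (h.powIntegrable_evolve hp hf t).integrable hI.integral_prod_left
    fun x => h.abs_evolve_rpow_le hp hf ht x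

lemma evolve_nonneg (hf : ∀ x, 0 ≤ f x) (t : ℝ) (x : Rd d) : 0 ≤ evolve k t f x := by
  unfold evolve
  split_ifs with ht
  · exact integral_nonneg fun y => mul_nonneg (hf y) (h.nonneg t ht _)
  · exact hf x

omit h in
lemma _root_.HardyStein.evolve_neg (t : ℝ) (x : Rd d) :
    evolve k t (fun y => -f y) x = -evolve k t f x := by
  unfold evolve
  split_ifs
  · simp [integral_neg]
  · rfl

lemma evolve_add (hp : 1 ≤ p) (hf : PowIntegrable p f) {g : Rd d → ℝ} (hg : PowIntegrable p g)
    (t : ℝ) (x : Rd d) : evolve k t (fun y => f y + g y) x = evolve k t f x + evolve k t g x := by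
  unfold evolve
  split_ifs with ht
  · rw [← integral_add (h.integrable_mul hp hf ht x) (h.integrable_mul hp hg ht x)]
    congr 1; ext y; ring
  · rfl

lemma evolve_sub (hp : 1 ≤ p) (hf : PowIntegrable p f) {g : Rd d → ℝ} (hg : PowIntegrable p g)
    (t : ℝ) (x : Rd d) : evolve k t (fun y => f y - g y) x = evolve k t f x - evolve k t g x := by
  simp_rw [sub_eq_add_neg]
  rw [h.evolve_add hp hf hg.neg, evolve_neg]

lemma integral_mul_kernel {s t : ℝ} (hs : 0 < s) (ht : 0 < t) (x z : Rd d) :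
    ∫ y, k t (z - y) * k s (y - x) = k (s + t) (z - x) := by
  rw [← h.convolution s t hs ht]
  have := integral_sub_right_eq_self (fun w => k s w * k t (z - x - w)) x (μ := volume)
  rw [← this]
  congr 1; ext y
  rw [mul_comm]
  congr 2
  abel

/-- The semigroup property. -/
lemma evolve_evolve (hp : 1 ≤ p) (hf : PowIntegrable p f) {s t : ℝ} (hs : 0 < s) (ht : 0 ≤ t) :
    evolve k s (evolve k t f) = evolve k (s + t) f := by
  rcases ht.eq_or_lt with rfl | ht
  · rw [evolve_zero, add_zero]
  ext x
  rw [evolve_of_pos hs, evolve_of_pos (add_pos hs ht)]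
  simp_rw [evolve_of_pos ht, ← integral_mul_const]
  have hk := h.measurable_apply
  have hfm := hf.measurable
  -- Fubini is justified by integrating absolute values over the intermediate point first: the two
  -- kernels merge into the one at time s + t.
  have hI : Integrable (fun q : Rd d × Rd d => f q.2 * k t (q.2 - q.1) * k s (q.1 - x))
      (volume.prod volume) := by
    have hks := hk s
    have hkt := hk t
    rw [integrable_prod_iff' (by fun_prop)]
    constructor
    · refine Eventually.of_forall fun z => ?_
      obtain ⟨M, hM⟩ := h.exists_bound ht
      simp only [mul_assoc]
      refine Integrable.const_mul ?_ _
      exact (h.integrable_sub hs x).bdd_mul (c := M)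
        (hkt.comp (measurable_const.sub measurable_id)).aestronglyMeasurable
        (Eventually.of_forall fun y => hM _)
    · refine (h.integrable_mul hp hf.abs (add_pos hs ht) x).congr
        (Eventually.of_forall fun z => ?_)
      simp only
      rw [← h.integral_mul_kernel hs ht, ← integral_const_mul]
      congr 1; ext y
      rw [norm_mul, norm_mul, Real.norm_eq_abs, Real.norm_eq_abs, Real.norm_eq_abs,
        abs_of_nonneg (h.nonneg s hs _), abs_of_nonneg (h.nonneg t ht _), mul_assoc]
  rw [integral_integral_swap hI]
  congr 1; ext z
  simp_rw [mul_assoc]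
  rw [integral_const_mul, h.integral_mul_kernel hs ht]

end IsHeatKernel

end HardyStein

/-! ### Time regularity of the semigroup and decay at infinity -/

namespace HardyStein

variable {d : ℕ}

namespace IsHeatKernel

variable {ν : Rd d → ℝ} {k : ℝ → Rd d → ℝ} (h : IsHeatKernel ν k)
  {p : ℝ} {f : Rd d → ℝ}

include h

/-- A bounded integrable majorant of the kernel, locally uniform in time. -/
lemma exists_dominating {a b : ℝ} (ha : 0 < a) (hb : 0 < b) : ∃ (D : Rd d → ℝ) (M : ℝ),
    Integrable D ∧ (∀ x, |D x| ≤ M) ∧ ∀ s, a ≤ s → s ≤ b → ∀ x, k s x ≤ D x := by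
  obtain ⟨M, hMa, -, hM⟩ := h.sup_bound
  obtain ⟨c, hc0, hc⟩ := h.relative_bound
  have hM0 : 0 ≤ M a := (h.nonneg a ha 0).trans (hM a ha 0)
  set D₀ : Rd d → ℝ := fun x => (Metric.closedBall (0 : Rd d) 1).indicator (fun _ => M a) x
    + c * b * (min (‖x‖ ^ 2) 1 * ν x) with hD₀
  have hD₀0 : ∀ x, 0 ≤ D₀ x := by
    intro x
    have h1 := h.levy.min_mul_nonneg x
    have h2 : 0 ≤ (Metric.closedBall (0 : Rd d) 1).indicator (fun _ => M a) x :=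
      indicator_nonneg (fun _ _ => hM0) x
    simp only [hD₀]
    positivity
  have hI : Integrable D₀ := by
    refine Integrable.add ?_ (h.levy.integrable.const_mul _)
    rw [integrable_indicator_iff measurableSet_closedBall]
    exact integrableOn_const measure_closedBall_lt_top.ne
  -- `D₀` is integrable but may be unbounded; the minimum with `M a` provides the bound needed for
  -- pairing with an L^p function.
  refine ⟨fun x => min (M a) (D₀ x), M a, ?_, fun x => ?_, fun s has hsb x => le_min ?_ ?_⟩
  · refine hI.mono' (aestronglyMeasurable_const.inf hI.aestronglyMeasurable)
      (Eventually.of_forall fun x => ?_)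
    rw [Real.norm_eq_abs, abs_of_nonneg (le_min hM0 (hD₀0 x))]
    exact min_le_right _ _
  · rw [abs_of_nonneg (le_min hM0 (hD₀0 x))]
    exact min_le_left _ _
  · have hs := ha.trans_le has
    exact (hM s hs x).trans (hMa ha hs has)
  · have hs := ha.trans_le has
    have h0 := h.levy.min_mul_nonneg x
    by_cases hx : ‖x‖ ≤ 1
    · simp only [hD₀]
      rw [indicator_of_mem (by simpa using hx)]
      have h1 := (hM s hs x).trans (hMa ha hs has)
      have h2 : 0 ≤ c * b * (min (‖x‖ ^ 2) 1 * ν x) := by positivity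
      linarith
    · simp only [hD₀]
      rw [indicator_of_notMem (by simpa using hx), zero_add]
      push Not at hx
      have hx0 : x ≠ 0 := by
        rintro rfl
        simp at hx
        linarith
      rw [min_eq_right (by nlinarith), one_mul]
      refine (hc s hs x hx0).trans ?_
      have := h.levy.pos x hx0
      gcongr

lemma continuousAt_evolve (hp : 1 ≤ p) (hf : PowIntegrable p f) {t : ℝ} (ht : 0 < t) (x : Rd d) :
    ContinuousAt (fun s => evolve k s f x) t := by
  obtain ⟨D, M, hD, hM, hkD⟩ := h.exists_dominating (half_pos ht) (show 0 < t + 1 by linarith)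
  have hnear : ∀ᶠ s in 𝓝 t, t / 2 < s ∧ s < t + 1 :=
    (lt_mem_nhds (half_lt_self ht)).and (gt_mem_nhds (by linarith))
  have h1 : ContinuousAt (fun s => ∫ y, f y * k s (y - x)) t := by
    refine continuousAt_of_dominated (bound := fun y => |f y| * D (y - x)) ?_ ?_
      (hf.abs.integrable_mul hp (hD.comp_sub_right x) fun y => hM _) ?_
    · refine Eventually.of_forall fun s => ?_
      exact (hf.measurable.mul ((h.measurable_apply s).comp
        (measurable_id.sub measurable_const))).aestronglyMeasurable
    · filter_upwards [hnear] with s hs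
      refine Eventually.of_forall fun y => ?_
      have hs0 : 0 < s := (half_pos ht).trans hs.1
      rw [norm_mul, Real.norm_eq_abs, Real.norm_eq_abs, abs_of_nonneg (h.nonneg s hs0 _)]
      exact mul_le_mul_of_nonneg_left (hkD s hs.1.le hs.2.le _) (abs_nonneg _)
    · refine Eventually.of_forall fun y => continuousAt_const.mul ?_
      exact (h.continuousOn (y - x)).continuousAt (Ioi_mem_nhds ht)
  refine h1.congr ?_
  filter_upwards [lt_mem_nhds ht] with s hs
  exact (evolve_of_pos hs f x).symm

/-- The kernels concentrate at the origin as `t → 0⁺`. -/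
lemma tendsto_integral_mul_zero {ω : Rd d → ℝ} {B : ℝ} (h0 : ∀ z, 0 ≤ ω z) (hB : ∀ z, ω z ≤ B)
    (hω : Tendsto ω (𝓝 0) (𝓝 0)) :
    Tendsto (fun t => ∫ z, ω z * k t z) (𝓝[>] 0) (𝓝 0) := by
  obtain ⟨c, hc0, hc⟩ := h.relative_bound
  have hB0 : 0 ≤ B := (h0 0).trans (hB 0)
  have hnn : ∀ t, 0 < t → 0 ≤ ∫ z, ω z * k t z := fun t ht =>
    integral_nonneg fun z => mul_nonneg (h0 z) (h.nonneg t ht z)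
  rw [Metric.tendsto_nhds]
  intro ε hε
  obtain ⟨δ, hδ, hωδ⟩ := Metric.eventually_nhds_iff.mp
    ((Metric.tendsto_nhds.mp hω) (ε / 2) (half_pos hε))
  set δ' := min δ 1
  have hδ' : 0 < δ' := lt_min hδ one_pos
  have hT := h.levy.integrable_truncation hδ' (min_le_right _ _)
  set V := ∫ z, {x : Rd d | δ' ≤ ‖x‖}.indicator ν z
  -- Outside the ball of radius `δ'` the kernel is at most c t ν, so it carries mass O(t); inside
  -- the ball ω is below ε/2.
  have key : ∀ t, 0 < t → ∫ z, ω z * k t z ≤ ε / 2 + B * c * t * V := by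
    intro t ht
    have hle : ∫ z, ω z * k t z ≤ ∫ z, (ε / 2 * k t z + B * c * t *
        {x : Rd d | δ' ≤ ‖x‖}.indicator ν z) := by
      refine integral_mono_of_nonneg
        (Eventually.of_forall fun z => mul_nonneg (h0 z) (h.nonneg t ht z))
        (((h.integrable t ht).const_mul _).add (hT.const_mul _))
        (Eventually.of_forall fun z => ?_)
      simp only
      have hk := h.nonneg t ht z
      by_cases hz : δ' ≤ ‖z‖
      · rw [indicator_of_mem (show z ∈ {x : Rd d | δ' ≤ ‖x‖} from hz)]
        have hz0 : z ≠ 0 := norm_pos_iff.mp (hδ'.trans_le hz)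
        calc ω z * k t z ≤ B * (c * t * ν z) :=
              mul_le_mul (hB z) (hc t ht z hz0) hk hB0
          _ ≤ _ := by
              have : 0 ≤ ε / 2 * k t z := by positivity
              linarith
      · rw [indicator_of_notMem (show z ∉ {x : Rd d | δ' ≤ ‖x‖} from hz), mul_zero, add_zero]
        refine mul_le_mul_of_nonneg_right ?_ hk
        have hz1 : ‖z‖ < δ := (not_le.mp hz).trans_le (min_le_left _ _)
        have := hωδ (y := z) (by simpa using hz1)
        rw [Real.dist_eq, sub_zero, abs_of_nonneg (h0 z)] at this
        exact this.le
    rw [integral_add ((h.integrable t ht).const_mul _) (hT.const_mul _), integral_const_mul,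
      integral_const_mul, h.integral_eq_one t ht, mul_one] at hle
    exact hle
  have hlim : Tendsto (fun t : ℝ => ε / 2 + B * c * t * V) (𝓝[>] 0) (𝓝 (ε / 2)) := by
    have : Continuous fun t : ℝ => ε / 2 + B * c * t * V := by fun_prop
    have h2 := this.tendsto 0
    simp only [mul_zero, zero_mul, add_zero] at h2
    exact h2.mono_left nhdsWithin_le_nhds
  filter_upwards [hlim.eventually_lt_const (half_lt_self hε), self_mem_nhdsWithin] with t ht ht0
  rw [Real.dist_eq, sub_zero, abs_of_nonneg (hnn t ht0)]
  exact (key t ht0).trans_lt ht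

/-- Strong continuity of the semigroup at time zero. -/
lemma tendsto_integral_abs_evolve_sub (hp : 1 ≤ p) (hf : PowIntegrable p f) :
    Tendsto (fun t => ∫ x, |evolve k t f x - f x| ^ p) (𝓝[>] 0) (𝓝 0) := by
  have hp0 : 0 ≤ p := by linarith
  have hshift : ∀ z, Integrable fun x => |f (x - z)| ^ p := fun z =>
    hf.integrable.comp_sub_right z
  -- By Jensen and Fubini the L^p error is at most the kernel average of this modulus of continuity,
  -- which is bounded and vanishes at 0.
  have hω := h.tendsto_integral_mul_zero (ω := fun z => ∫ x, |f (x - z) - f x| ^ p)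
    (B := 2 ^ p * ((∫ x, |f x| ^ p) + ∫ x, |f x| ^ p))
    (fun z => integral_nonneg fun x => by positivity) (fun z => ?_)
    (hf.tendsto_integral_translation hp)
  swap
  · calc ∫ x, |f (x - z) - f x| ^ p ≤ ∫ x, 2 ^ p * (|f (x - z)| ^ p + |f x| ^ p) :=
          integral_mono_of_nonneg (Eventually.of_forall fun x => by positivity)
            (((hshift z).add hf.integrable).const_mul _)
            (Eventually.of_forall fun x => abs_sub_rpow_le hp0 _ _)
      _ = _ := by
          rw [integral_const_mul, integral_add (hshift z) hf.integrable,
            integral_sub_right_eq_self (fun x => |f x| ^ p) z]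
  refine tendsto_of_tendsto_of_tendsto_of_le_of_le' tendsto_const_nhds hω
    (Eventually.of_forall fun t => integral_nonneg fun x => by positivity) ?_
  filter_upwards [self_mem_nhdsWithin] with t ht
  have ht : 0 < t := ht
  have hfm := hf.measurable
  have hkm := h.measurable_apply t
  have hP : Integrable (fun q : Rd d × Rd d => |f (q.1 - q.2) - f q.1| ^ p * k t q.2)
      (volume.prod volume) := by
    have h1 := Integrable.convolution_integrand (ContinuousLinearMap.mul ℝ ℝ)
      (h.integrable t ht) hf.integrable
    have h2 := hf.integrable.mul_prod (h.integrable t ht)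
    refine ((h1.add h2).const_mul (2 ^ p)).mono' ?_ (Eventually.of_forall fun q => ?_)
    · have hm : Measurable fun q : Rd d × Rd d => |f (q.1 - q.2) - f q.1| :=
        ((hfm.comp (measurable_fst.sub measurable_snd)).sub (hfm.comp measurable_fst)).abs
      exact ((hm.pow_const p).mul (hkm.comp measurable_snd)).aestronglyMeasurable
    · have hk := h.nonneg t ht q.2
      rw [Real.norm_eq_abs, abs_of_nonneg (by positivity)]
      have := mul_le_mul_of_nonneg_right (abs_sub_rpow_le hp0 (f (q.1 - q.2)) (f q.1)) hk
      refine this.trans (le_of_eq ?_)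
      simp only [ContinuousLinearMap.mul_apply', Pi.add_apply]
      ring
  have hpt : ∀ x, |evolve k t f x - f x| ^ p ≤ ∫ z, |f (x - z) - f x| ^ p * k t z := by
    intro x
    have hI1 : Integrable fun y => (f y - f x) * k t (y - x) := by
      simp_rw [sub_mul]
      exact (h.integrable_mul hp hf ht x).sub ((h.integrable_sub ht x).const_mul _)
    have hI2 : Integrable fun y => |f y - f x| * k t (y - x) := by
      refine hI1.abs.congr (Eventually.of_forall fun y => ?_)
      simp only
      rw [abs_mul, abs_of_nonneg (h.nonneg t ht _)]
    have hI3 : Integrable fun y => |f y - f x| ^ p * k t (y - x) := by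
      refine (((h.integrable_rpow_mul hf ht x).add
        ((h.integrable_sub ht x).const_mul (|f x| ^ p))).const_mul (2 ^ p)).mono' ?_
        (Eventually.of_forall fun y => ?_)
      · exact (((hfm.sub_const _).abs.pow_const p).mul
          (hkm.comp (measurable_id.sub measurable_const))).aestronglyMeasurable
      · have hk := h.nonneg t ht (y - x)
        rw [Real.norm_eq_abs, abs_of_nonneg (by positivity)]
        have := mul_le_mul_of_nonneg_right (abs_sub_rpow_le hp0 (f y) (f x)) hk
        refine this.trans (le_of_eq ?_)
        simp only [Pi.add_apply]
        ring
    have e1 : evolve k t f x - f x = ∫ y, (f y - f x) * k t (y - x) := by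
      simp_rw [sub_mul]
      rw [integral_sub (h.integrable_mul hp hf ht x) ((h.integrable_sub ht x).const_mul _),
        h.integral_fst_mul ht, evolve_of_pos ht]
    have e2 : |evolve k t f x - f x| ≤ ∫ y, |f y - f x| * k t (y - x) := by
      rw [e1]
      refine abs_integral_le_integral_abs.trans (le_of_eq ?_)
      congr 1; ext y
      rw [abs_mul, abs_of_nonneg (h.nonneg t ht _)]
    refine (Real.rpow_le_rpow (abs_nonneg _) e2 hp0).trans ?_
    refine (rpow_integral_mul_le hp (fun y => abs_nonneg _) (fun y => h.nonneg t ht _)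
      (h.integrable_sub ht x) (h.integral_sub_eq_one ht x) hI2 hI3).trans (le_of_eq ?_)
    rw [← integral_sub_left_eq_self (fun y => |f y - f x| ^ p * k t (y - x)) volume x]
    congr 1; ext z
    rw [show x - z - x = -z by abel, h.neg t ht]
  calc ∫ x, |evolve k t f x - f x| ^ p
      ≤ ∫ x, ∫ z, |f (x - z) - f x| ^ p * k t z :=
        integral_mono_of_nonneg (Eventually.of_forall fun x => by positivity)
          hP.integral_prod_left (Eventually.of_forall hpt)
    _ = ∫ z, ∫ x, |f (x - z) - f x| ^ p * k t z := integral_integral_swap hP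
    _ = _ := by simp_rw [integral_mul_const]

/-- The semigroup vanishes in the mean of order `p > 1` at time infinity. -/
lemma tendsto_integral_abs_evolve_atTop (hp : 1 < p) (hf : PowIntegrable p f) :
    Tendsto (fun t => ∫ x, |evolve k t f x| ^ p) atTop (𝓝 0) := by
  have hp0 : 0 < p := by linarith
  rw [Metric.tendsto_nhds]
  intro ε hε
  obtain ⟨M, -, hMt, hM⟩ := h.sup_bound
  set η := ε / (2 * 2 ^ p)
  have hη : 0 < η := by positivity
  obtain ⟨g, hgc, hgε, hgcont, hgL⟩ := (hf.memLp hp0).exists_hasCompactSupport_integral_rpow_sub_le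
    hp0 hη
  have hg := PowIntegrable.of_memLp hp0 hgcont.measurable hgL
  have hgI : Integrable g := hgcont.integrable_of_hasCompactSupport hgc
  have hr := hf.sub hp0.le hg
  set L := ∫ x, |g x|
  -- Interpolation between L^1 and L^∞: the semigroup contracts L^1 and maps it to L^∞ with norm at
  -- most `M t`. As p > 1 the right side vanishes as t → ∞; the rest f - g is controlled by
  -- contractivity.
  have hgt : ∀ t, 0 < t → ∫ x, |evolve k t g x| ^ p ≤ (M t * L) ^ (p - 1) * L := by
    intro t ht
    have hI := h.integrable_snd_mul ht hgI.abs
    have hsup : ∀ x, |evolve k t g x| ≤ M t * L := by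
      intro x
      refine (h.abs_evolve_le ht g x).trans ?_
      rw [mul_comm, ← integral_mul_const]
      refine integral_mono_of_nonneg
        (Eventually.of_forall fun y => mul_nonneg (abs_nonneg _) (h.nonneg t ht _))
        (hgI.abs.mul_const _) (Eventually.of_forall fun y => ?_)
      exact mul_le_mul_of_nonneg_left (hM t ht _) (abs_nonneg _)
    calc ∫ x, |evolve k t g x| ^ p
        ≤ ∫ x, (M t * L) ^ (p - 1) * ∫ y, |g y| * k t (y - x) := by
          refine integral_mono_of_nonneg (Eventually.of_forall fun x => by positivity)
            (hI.integral_prod_left.const_mul _) (Eventually.of_forall fun x => ?_)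
          have e : |evolve k t g x| ^ p = |evolve k t g x| ^ (p - 1) * |evolve k t g x| := by
            rw [rpow_mul_self (abs_nonneg _) (by linarith), sub_add_cancel]
          simp only
          rw [e]
          have h1 := hsup x
          have h2 := h.abs_evolve_le ht g x
          have h3 : 0 ≤ M t * L := (abs_nonneg _).trans h1
          exact mul_le_mul (Real.rpow_le_rpow (abs_nonneg _) h1 (by linarith)) h2 (abs_nonneg _)
            (by positivity)
      _ = (M t * L) ^ (p - 1) * L := by
          rw [integral_const_mul, ← integral_prod _ hI, h.integral_prod_snd_mul ht hgI.abs]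
  have hlim : Tendsto (fun t => 2 ^ p * ((M t * L) ^ (p - 1) * L + η)) atTop
      (𝓝 (2 ^ p * ((0 * L) ^ (p - 1) * L + η))) :=
    ((((hMt.mul_const L).rpow_const (Or.inr (by linarith))).mul_const L).add_const η).const_mul _
  have hval : (2 : ℝ) ^ p * ((0 * L) ^ (p - 1) * L + η) = ε / 2 := by
    rw [zero_mul, Real.zero_rpow (by linarith), zero_mul, zero_add]
    simp only [η]
    field_simp
  rw [hval] at hlim
  filter_upwards [hlim.eventually_lt_const (half_lt_self hε), eventually_gt_atTop 0] with t ht ht0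
  rw [Real.dist_eq, sub_zero, abs_of_nonneg (integral_nonneg fun x => by positivity)]
  refine lt_of_le_of_lt ?_ ht
  have hgp := h.powIntegrable_evolve hp.le hg t
  have hrp := h.powIntegrable_evolve hp.le hr t
  calc ∫ x, |evolve k t f x| ^ p
      ≤ ∫ x, 2 ^ p * (|evolve k t g x| ^ p + |evolve k t (fun y => f y - g y) x| ^ p) := by
        refine integral_mono_of_nonneg (Eventually.of_forall fun x => by positivity)
          ((hgp.integrable.add hrp.integrable).const_mul _) (Eventually.of_forall fun x => ?_)
        have := abs_add_rpow_le hp0.le (evolve k t g x) (evolve k t (fun y => f y - g y) x)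
        simp only
        rw [h.evolve_sub hp.le hf hg] at this ⊢
        simpa using this
    _ = 2 ^ p * ((∫ x, |evolve k t g x| ^ p) +
          ∫ x, |evolve k t (fun y => f y - g y) x| ^ p) := by
        rw [integral_const_mul, integral_add hgp.integrable hrp.integrable]
    _ ≤ _ := by
        gcongr
        · exact hgt t ht0
        · exact (h.integral_abs_evolve_rpow_le hp.le hr ht0).trans hgε

end IsHeatKernel

end HardyStein

/-! ### Averaged Bregman divergences and the energy along the semigroup -/

namespace HardyStein

variable {d : ℕ}

/-- A form of Young's inequality, by comparing `b` with `η * a`; either term alone suffices in its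
case. -/
lemma rpow_sub_one_mul_le {p a b η : ℝ} (hp : 1 ≤ p) (ha : 0 ≤ a) (hb : 0 ≤ b) (hη : 0 < η) :
    a ^ (p - 1) * b ≤ η * a ^ p + η ^ (1 - p) * b ^ p := by
  have e : ∀ c : ℝ, 0 ≤ c → c ^ (p - 1) * c = c ^ p := fun c hc => by
    rw [rpow_mul_self hc (by linarith), sub_add_cancel]
  have hap := Real.rpow_nonneg ha p
  have hbp := Real.rpow_nonneg hb p
  have hη' := Real.rpow_nonneg hη.le (1 - p)
  rcases le_total b (η * a) with h | h
  · calc a ^ (p - 1) * b ≤ a ^ (p - 1) * (η * a) := by gcongr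
      _ = η * a ^ p := by rw [← e a ha]; ring
      _ ≤ _ := by linarith [mul_nonneg hη' hbp]
  · have h' : a ≤ η⁻¹ * b := by rwa [← div_eq_inv_mul, le_div_iff₀' hη]
    calc a ^ (p - 1) * b ≤ (η⁻¹ * b) ^ (p - 1) * b := by
          gcongr
      _ = η ^ (1 - p) * b ^ p := by
          rw [Real.mul_rpow (by positivity) hb, mul_assoc, e b hb, Real.inv_rpow hη.le,
            ← Real.rpow_neg hη.le, neg_sub]
      _ ≤ _ := by linarith [mul_nonneg hη.le hap]

/-- A pair of functions with integrable `p`-th powers. -/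
structure PairPowIntegrable (p : ℝ) (U : Rd d → ℝ × ℝ) : Prop where
  fst : PowIntegrable p fun x => (U x).1
  snd : PowIntegrable p fun x => (U x).2

lemma PairPowIntegrable.measurable {p : ℝ} {U : Rd d → ℝ × ℝ} (hU : PairPowIntegrable p U) :
    Measurable U :=
  hU.fst.measurable.prodMk hU.snd.measurable

lemma norm_rpow_le (p : ℝ) (w : ℝ × ℝ) : ‖w‖ ^ p ≤ |w.1| ^ p + |w.2| ^ p := by
  rw [Prod.norm_def, Real.norm_eq_abs, Real.norm_eq_abs]
  rcases max_choice |w.1| |w.2| with h | h <;> rw [h]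
  · linarith [Real.rpow_nonneg (abs_nonneg w.2) p]
  · linarith [Real.rpow_nonneg (abs_nonneg w.1) p]

lemma PairPowIntegrable.integrable_norm {p : ℝ} {U : Rd d → ℝ × ℝ}
    (hU : PairPowIntegrable p U) : Integrable fun x => ‖U x‖ ^ p := by
  refine (hU.fst.integrable.add hU.snd.integrable).mono'
    (hU.measurable.norm.pow_const p).aestronglyMeasurable (Eventually.of_forall fun x => ?_)
  rw [Real.norm_eq_abs, abs_of_nonneg (by positivity)]
  exact norm_rpow_le p _

lemma bregman_self (Y Y₁ Y₂ : ℝ × ℝ → ℝ) (w : ℝ × ℝ) : bregman Y Y₁ Y₂ w w = 0 := by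
  simp [bregman]

namespace IsConvexPotential

variable {p : ℝ} {Y Y₁ Y₂ : ℝ × ℝ → ℝ} (V : IsConvexPotential p Y Y₁ Y₂)

include V

lemma abs_bregman_le (hp : 1 ≤ p) : ∃ C, 0 ≤ C ∧
    ∀ w z, |bregman Y Y₁ Y₂ w z| ≤ C * (‖w‖ ^ p + ‖z‖ ^ p) := by
  obtain ⟨C, hC, hY, hY1, hY2⟩ := V.bound
  refine ⟨5 * C, by positivity, fun w z => ?_⟩
  have key : ∀ a b c : ℝ, |a| ≤ C * ‖w‖ ^ (p - 1) → |b| ≤ ‖z‖ → |c| ≤ ‖w‖ →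
      |a * (b - c)| ≤ C * (2 * ‖w‖ ^ p + ‖z‖ ^ p) := by
    intro a b c ha hb hc
    have h1 := rpow_sub_one_mul_le hp (norm_nonneg w) (norm_nonneg z) one_pos
    simp only [one_mul, Real.one_rpow] at h1
    have h2 : ‖w‖ ^ (p - 1) * ‖w‖ = ‖w‖ ^ p := by
      rw [rpow_mul_self (norm_nonneg w) (by linarith), sub_add_cancel]
    have h3 : |b - c| ≤ ‖z‖ + ‖w‖ := (abs_sub b c).trans (add_le_add hb hc)
    rw [abs_mul]
    calc |a| * |b - c| ≤ (C * ‖w‖ ^ (p - 1)) * (‖z‖ + ‖w‖) := by gcongr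
      _ = C * (‖w‖ ^ (p - 1) * ‖z‖ + ‖w‖ ^ p) := by rw [← h2]; ring
      _ ≤ C * ((‖w‖ ^ p + ‖z‖ ^ p) + ‖w‖ ^ p) := by gcongr
      _ = _ := by ring
  have k1 := key _ z.1 w.1 (hY1 w) (norm_fst_le z) (norm_fst_le w)
  have k2 := key _ z.2 w.2 (hY2 w) (norm_snd_le z) (norm_snd_le w)
  have k3 := hY w
  have k4 := hY z
  unfold bregman
  rw [abs_le] at *
  constructor <;> nlinarith [mul_nonneg hC (Real.rpow_nonneg (norm_nonneg w) p),
    mul_nonneg hC (Real.rpow_nonneg (norm_nonneg z) p)]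

lemma measurable_bregman : Measurable fun q : (ℝ × ℝ) × (ℝ × ℝ) => bregman Y Y₁ Y₂ q.1 q.2 :=
  V.continuous_bregman.measurable

lemma integrable_comp {U : Rd d → ℝ × ℝ} (hU : PairPowIntegrable p U) :
    Integrable fun x => Y (U x) := by
  obtain ⟨C, hC, hY, -, -⟩ := V.bound
  exact ((hU.integrable_norm).const_mul C).mono'
    (V.continuous.measurable.comp hU.measurable).aestronglyMeasurable
    (Eventually.of_forall fun x => hY _)

lemma integrable_bregman (hp : 1 ≤ p) {W U : Rd d → ℝ × ℝ} (hW : PairPowIntegrable p W)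
    (hU : PairPowIntegrable p U) : Integrable fun x => bregman Y Y₁ Y₂ (W x) (U x) := by
  obtain ⟨C, hC, hB⟩ := V.abs_bregman_le hp
  exact (((hW.integrable_norm).add (hU.integrable_norm)).const_mul C).mono'
    (V.measurable_bregman.comp (hW.measurable.prodMk hU.measurable)).aestronglyMeasurable
    (Eventually.of_forall fun x => hB _ _)

variable {ν : Rd d → ℝ} {k : ℝ → Rd d → ℝ} (h : IsHeatKernel ν k)

include h

lemma integrable_bregman_mul_kernel (hp : 1 ≤ p) {W U : Rd d → ℝ × ℝ}
    (hW : PairPowIntegrable p W) (hU : PairPowIntegrable p U) {t : ℝ} (ht : 0 < t) :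
    Integrable (fun q : Rd d × Rd d => bregman Y Y₁ Y₂ (W q.1) (U q.2) * k t (q.2 - q.1))
      (volume.prod volume) := by
  obtain ⟨C, hC, hB⟩ := V.abs_bregman_le hp
  refine (((h.integrable_fst_mul ht (hW.integrable_norm)).add
    (h.integrable_snd_mul ht (hU.integrable_norm))).const_mul C).mono' ?_
    (Eventually.of_forall fun q => ?_)
  · exact ((V.measurable_bregman.comp ((hW.measurable.comp measurable_fst).prodMk
      (hU.measurable.comp measurable_snd))).mul
      ((h.measurable_apply t).comp (measurable_snd.sub measurable_fst))).aestronglyMeasurable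
  · have hk := h.nonneg t ht (q.2 - q.1)
    rw [norm_mul, Real.norm_eq_abs, Real.norm_eq_abs, abs_of_nonneg hk]
    refine (mul_le_mul_of_nonneg_right (hB _ _) hk).trans (le_of_eq ?_)
    simp only [Pi.add_apply]
    ring

/-- Averaging the Bregman divergence over the kernel. -/
lemma integral_bregman_mul_kernel (hp : 1 ≤ p) {W U PU : Rd d → ℝ × ℝ}
    (hW : PairPowIntegrable p W) (hU : PairPowIntegrable p U) {t : ℝ} (ht : 0 < t)
    (hPU1 : ∀ x, (PU x).1 = evolve k t (fun y => (U y).1) x)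
    (hPU2 : ∀ x, (PU x).2 = evolve k t (fun y => (U y).2) x) :
    ∫ q : Rd d × Rd d, bregman Y Y₁ Y₂ (W q.1) (U q.2) * k t (q.2 - q.1) ∂(volume.prod volume)
      = (∫ x, Y (U x)) - (∫ x, Y (PU x)) + ∫ x, bregman Y Y₁ Y₂ (W x) (PU x) := by
  have hPU : PairPowIntegrable p PU := by
    constructor
    · simp_rw [hPU1]; exact h.powIntegrable_evolve hp hU.fst t
    · simp_rw [hPU2]; exact h.powIntegrable_evolve hp hU.snd t
  have hB := V.integrable_bregman_mul_kernel h hp hW hU ht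
  have hY := h.integrable_snd_mul ht (V.integrable_comp hU)
  have hT : Integrable (fun q : Rd d × Rd d => Y (U q.2) * k t (q.2 - q.1) -
      bregman Y Y₁ Y₂ (W q.1) (U q.2) * k t (q.2 - q.1)) (volume.prod volume) := hY.sub hB
  have e1 : ∫ q : Rd d × Rd d, bregman Y Y₁ Y₂ (W q.1) (U q.2) * k t (q.2 - q.1)
      ∂(volume.prod volume) = (∫ x, Y (U x)) - ∫ q : Rd d × Rd d, (Y (U q.2) * k t (q.2 - q.1) -
        bregman Y Y₁ Y₂ (W q.1) (U q.2) * k t (q.2 - q.1)) ∂(volume.prod volume) := by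
    rw [integral_sub hY hB, h.integral_prod_snd_mul ht (V.integrable_comp hU)]
    ring
  rw [e1, integral_prod _ hT, sub_add, ← integral_sub (V.integrable_comp hPU)
    (V.integrable_bregman hp hW hPU)]
  congr 2; ext x
  -- The difference is affine in `U y`, so averaging over the kernel just replaces `U` by `PU`.
  have e2 : ∀ y, Y (U y) * k t (y - x) - bregman Y Y₁ Y₂ (W x) (U y) * k t (y - x) =
      (Y (W x) - Y₁ (W x) * (W x).1 - Y₂ (W x) * (W x).2) * k t (y - x) +
      (Y₁ (W x) * ((U y).1 * k t (y - x)) + Y₂ (W x) * ((U y).2 * k t (y - x))) := by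
    intro y
    unfold bregman
    ring
  have i1 := (h.integrable_mul hp hU.fst ht x).const_mul (Y₁ (W x))
  have i2 := (h.integrable_mul hp hU.snd ht x).const_mul (Y₂ (W x))
  have i3 : Integrable fun y => Y₁ (W x) * ((U y).1 * k t (y - x)) +
      Y₂ (W x) * ((U y).2 * k t (y - x)) := i1.add i2
  simp only [e2]
  rw [integral_add ((h.integrable_sub ht x).const_mul _) i3, integral_add i1 i2,
    integral_const_mul, integral_const_mul, integral_const_mul, h.integral_sub_eq_one ht,
    ← evolve_of_pos ht, ← evolve_of_pos ht, ← hPU1, ← hPU2]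
  unfold bregman
  ring

end IsConvexPotential

/-- The semigroup acting on a pair. -/
noncomputable def evolvePair (k : ℝ → Rd d → ℝ) (f g : Rd d → ℝ) (t : ℝ) (x : Rd d) : ℝ × ℝ :=
  (evolve k t f x, evolve k t g x)

namespace IsConvexPotential

variable {p : ℝ} {Y Y₁ Y₂ : ℝ × ℝ → ℝ} (V : IsConvexPotential p Y Y₁ Y₂)
  {ν : Rd d → ℝ} {k : ℝ → Rd d → ℝ} (h : IsHeatKernel ν k) {f g : Rd d → ℝ}

lemma _root_.HardyStein.IsHeatKernel.pairPowIntegrable_evolvePair (h : IsHeatKernel ν k)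
    (hp : 1 ≤ p) (hf : PowIntegrable p f)
    (hg : PowIntegrable p g) (t : ℝ) : PairPowIntegrable p (evolvePair k f g t) :=
  ⟨h.powIntegrable_evolve hp hf t, h.powIntegrable_evolve hp hg t⟩

include V h

/-- With the base point at the later time the remainder is the divergence of a point from itself, so
the identity is exact. -/
lemma integral_bregman_shift (hp : 1 ≤ p) (hf : PowIntegrable p f) (hg : PowIntegrable p g)
    {t s : ℝ} (ht : 0 ≤ t) (hs : 0 < s) :
    ∫ q : Rd d × Rd d, bregman Y Y₁ Y₂ (evolvePair k f g (t + s) q.1) (evolvePair k f g t q.2) *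
      k s (q.2 - q.1) ∂(volume.prod volume)
      = (∫ x, Y (evolvePair k f g t x)) - ∫ x, Y (evolvePair k f g (t + s) x) := by
  rw [V.integral_bregman_mul_kernel h hp (PU := evolvePair k f g (t + s))
    (h.pairPowIntegrable_evolvePair hp hf hg _)
    (h.pairPowIntegrable_evolvePair hp hf hg _) hs]
  · simp [bregman_self]
  · intro x
    simp only [evolvePair]
    rw [add_comm, ← h.evolve_evolve hp hf hs ht]
  · intro x
    simp only [evolvePair]
    rw [add_comm, ← h.evolve_evolve hp hg hs ht]

/-- With the base point at the earlier time the remainder is a nonnegative divergence and is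
dropped. -/
lemma sub_le_integral_bregman (hp : 1 ≤ p) (hf : PowIntegrable p f) (hg : PowIntegrable p g)
    (hf0 : ∀ x, 0 ≤ f x) {t s : ℝ} (ht : 0 ≤ t) (hs : 0 < s) :
    (∫ x, Y (evolvePair k f g t x)) - (∫ x, Y (evolvePair k f g (t + s) x)) ≤
    ∫ q : Rd d × Rd d, bregman Y Y₁ Y₂ (evolvePair k f g t q.1) (evolvePair k f g t q.2) *
      k s (q.2 - q.1) ∂(volume.prod volume) := by
  rw [V.integral_bregman_mul_kernel h hp (PU := evolvePair k f g (t + s))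
    (h.pairPowIntegrable_evolvePair hp hf hg _)
    (h.pairPowIntegrable_evolvePair hp hf hg _) hs]
  · have : 0 ≤ ∫ x, bregman Y Y₁ Y₂ (evolvePair k f g t x) (evolvePair k f g (t + s) x) :=
      integral_nonneg fun x => V.bregman_nonneg (h.evolve_nonneg hf0 t x)
        (h.evolve_nonneg hf0 (t + s) x)
    linarith
  · intro x
    simp only [evolvePair]
    rw [add_comm, ← h.evolve_evolve hp hf hs ht]
  · intro x
    simp only [evolvePair]
    rw [add_comm, ← h.evolve_evolve hp hg hs ht]

lemma antitoneOn_integral (hp : 1 ≤ p) (hf : PowIntegrable p f) (hg : PowIntegrable p g)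
    (hf0 : ∀ x, 0 ≤ f x) : AntitoneOn (fun t => ∫ x, Y (evolvePair k f g t x)) (Ici 0) := by
  intro t ht s _ hts
  rcases hts.eq_or_lt with rfl | hts
  · rfl
  have e := V.integral_bregman_shift h hp hf hg ht (sub_pos.mpr hts)
  rw [add_sub_cancel] at e
  have : 0 ≤ ∫ q : Rd d × Rd d, bregman Y Y₁ Y₂ (evolvePair k f g s q.1)
      (evolvePair k f g t q.2) * k (s - t) (q.2 - q.1) ∂(volume.prod volume) :=
    integral_nonneg fun q => mul_nonneg (V.bregman_nonneg (h.evolve_nonneg hf0 _ _)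
      (h.evolve_nonneg hf0 _ _)) (h.nonneg _ (sub_pos.mpr hts) _)
  simp only
  linarith

lemma integral_comp_nonneg (hf0 : ∀ x, 0 ≤ f x) (t : ℝ) : 0 ≤ ∫ x, Y (evolvePair k f g t x) :=
  integral_nonneg fun x => V.nonneg _ (h.evolve_nonneg hf0 t x)

lemma tendsto_integral_atTop (hp : 1 < p) (hf : PowIntegrable p f) (hg : PowIntegrable p g)
    (hf0 : ∀ x, 0 ≤ f x) : Tendsto (fun t => ∫ x, Y (evolvePair k f g t x)) atTop (𝓝 0) := by
  obtain ⟨C, hC, hY, -, -⟩ := V.bound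
  have hlim := ((h.tendsto_integral_abs_evolve_atTop hp hf).add
    (h.tendsto_integral_abs_evolve_atTop hp hg)).const_mul C
  simp only [add_zero, mul_zero] at hlim
  refine tendsto_of_tendsto_of_tendsto_of_le_of_le tendsto_const_nhds hlim
    (fun t => V.integral_comp_nonneg h hf0 t) fun t => ?_
  have hU := h.pairPowIntegrable_evolvePair hp.le hf hg t
  calc ∫ x, Y (evolvePair k f g t x)
      ≤ ∫ x, C * (|evolve k t f x| ^ p + |evolve k t g x| ^ p) := by
        refine integral_mono (V.integrable_comp hU)
          ((hU.fst.integrable.add hU.snd.integrable).const_mul C) fun x => ?_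
        refine (le_abs_self _).trans ((hY _).trans ?_)
        exact mul_le_mul_of_nonneg_left (norm_rpow_le p _) hC
    _ = C * ((∫ x, |evolve k t f x| ^ p) + ∫ x, |evolve k t g x| ^ p) := by
        rw [integral_const_mul]
        exact congrArg (C * ·) (integral_add hU.fst.integrable hU.snd.integrable)

/-- One side is monotonicity. For the other, convexity at the initial pair bounds the drop by
gradient times increment, and Young's inequality splits this into a small multiple of the initial
norm and the L^p error, which tends to 0. -/
lemma tendsto_integral_zero (hp : 1 ≤ p) (hf : PowIntegrable p f) (hg : PowIntegrable p g)
    (hf0 : ∀ x, 0 ≤ f x) : Tendsto (fun t => ∫ x, Y (evolvePair k f g t x)) (𝓝[>] 0)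
      (𝓝 (∫ x, Y (evolvePair k f g 0 x))) := by
  have hp0 : 0 ≤ p := by linarith
  obtain ⟨C, hC, -, hY1, hY2⟩ := V.bound
  set U := evolvePair k f g 0 with hUdef
  have hU : PairPowIntegrable p U := h.pairPowIntegrable_evolvePair hp hf hg 0
  set S := ∫ x, ‖U x‖ ^ p
  have hS : 0 ≤ S := integral_nonneg fun x => by positivity
  have hδ := (h.tendsto_integral_abs_evolve_sub hp hf).add
    (h.tendsto_integral_abs_evolve_sub hp hg)
  rw [add_zero] at hδ
  have key : ∀ η, 0 < η → ∀ t, 0 < t → (∫ x, Y (U x)) - (∫ x, Y (evolvePair k f g t x)) ≤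
      C * (2 * η * S + η ^ (1 - p) * ((∫ x, |evolve k t f x - f x| ^ p) +
        ∫ x, |evolve k t g x - g x| ^ p)) := by
    intro η hη t ht
    have hUt := h.pairPowIntegrable_evolvePair hp hf hg t
    have hdf := (h.powIntegrable_evolve hp hf t).sub hp0 hf
    have hdg := (h.powIntegrable_evolve hp hg t).sub hp0 hg
    have hd2 : Integrable fun x => |evolve k t f x - f x| ^ p + |evolve k t g x - g x| ^ p :=
      hdf.integrable.add hdg.integrable
    have hI : Integrable fun x => C * (2 * η * ‖U x‖ ^ p +
        η ^ (1 - p) * (|evolve k t f x - f x| ^ p + |evolve k t g x - g x| ^ p)) :=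
      (((hU.integrable_norm).const_mul _).add
        ((hdf.integrable.add hdg.integrable).const_mul _)).const_mul _
    rw [← integral_sub (V.integrable_comp hU) (V.integrable_comp hUt)]
    have hle : ∫ x, (Y (U x) - Y (evolvePair k f g t x)) ≤ ∫ x, C * (2 * η * ‖U x‖ ^ p +
        η ^ (1 - p) * (|evolve k t f x - f x| ^ p + |evolve k t g x - g x| ^ p)) := by
      refine integral_mono ((V.integrable_comp hU).sub (V.integrable_comp hUt)) hI
        fun x => ?_
      have ht1 := V.tangent (U x) (evolvePair k f g t x) (h.evolve_nonneg hf0 0 x)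
        (h.evolve_nonneg hf0 t x)
      have hUf : (U x).1 = f x := by simp [hUdef, evolvePair, evolve_zero]
      have hUg : (U x).2 = g x := by simp [hUdef, evolvePair, evolve_zero]
      have aux : ∀ a b : ℝ, |a| ≤ C * ‖U x‖ ^ (p - 1) →
          -(a * b) ≤ C * (η * ‖U x‖ ^ p + η ^ (1 - p) * |b| ^ p) := by
        intro a b ha
        calc -(a * b) ≤ |a * b| := neg_le_abs _
          _ = |a| * |b| := abs_mul _ _
          _ ≤ C * ‖U x‖ ^ (p - 1) * |b| := by gcongr
          _ = C * (‖U x‖ ^ (p - 1) * |b|) := by ring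
          _ ≤ _ := by
              gcongr
              exact rpow_sub_one_mul_le hp (norm_nonneg _) (abs_nonneg _) hη
      have a1 := aux _ ((evolvePair k f g t x).1 - (U x).1) (hY1 (U x))
      have a2 := aux _ ((evolvePair k f g t x).2 - (U x).2) (hY2 (U x))
      simp only [evolvePair] at a1 a2 ht1 ⊢
      rw [hUf] at a1 ht1
      rw [hUg] at a2 ht1
      linarith
    refine hle.trans (le_of_eq ?_)
    rw [integral_const_mul, integral_add ((hU.integrable_norm).const_mul _)
        (hd2.const_mul _), integral_const_mul,
      integral_const_mul, integral_add hdf.integrable hdg.integrable]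
  have hanti := V.antitoneOn_integral h hp hf hg hf0
  rw [Metric.tendsto_nhds]
  intro ε hε
  -- Makes C · 2ηS at most ε/2; the added 1 avoids a zero denominator.
  set η := ε / (2 * (2 * C * S + 1))
  have hη : 0 < η := by positivity
  have hlim := ((hδ.const_mul (η ^ (1 - p))).const_add (2 * η * S)).const_mul C
  simp only [mul_zero, add_zero] at hlim
  have hlt : C * (2 * η * S) < ε := by
    have : C * (2 * η * S) = ε / 2 * (2 * C * S / (2 * C * S + 1)) := by
      simp only [η]; field_simp
    rw [this]
    have h1 : 2 * C * S / (2 * C * S + 1) ≤ 1 := by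
      rw [div_le_one (by positivity)]; linarith
    nlinarith
  filter_upwards [hlim.eventually_lt_const hlt, self_mem_nhdsWithin] with t ht ht0
  have ht0 : 0 < t := ht0
  have h1 := hanti (mem_Ici.mpr le_rfl) (mem_Ici.mpr ht0.le) ht0.le
  have h2 := key η hη t ht0
  simp only at h1
  rw [Real.dist_eq, abs_sub_comm, abs_of_nonneg (by linarith)]
  linarith

end IsConvexPotential

end HardyStein

/-! ### Telescoping in time and the limit of small time steps -/

namespace HardyStein

/-- The truncated telescoping integral of an antitone function. -/
lemma setLIntegral_sub_shift_eq {G : ℝ → ℝ} (hG : AntitoneOn G (Ici 0)) {s T : ℝ} (hs : 0 < s)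
    (hT : 0 < T) :
    ∫⁻ t in Ioc 0 T, ENNReal.ofReal (G t - G (t + s))
      = ENNReal.ofReal ((∫ t in (0 : ℝ)..s, G t) - ∫ t in T..(T + s), G t) := by
  have hint : ∀ a b : ℝ, 0 ≤ a → 0 ≤ b → IntervalIntegrable G volume a b := by
    intro a b ha hb
    refine AntitoneOn.intervalIntegrable (hG.mono fun x hx => ?_)
    exact (le_min ha hb).trans (mem_uIcc.mp hx |>.elim (fun h => (min_le_left _ _).trans h.1)
      (fun h => (min_le_right _ _).trans h.1))
  have hsh : IntervalIntegrable (fun t => G (t + s)) volume 0 T := by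
    have := (hint s (T + s) hs.le (by linarith)).comp_add_right s
    simpa using this
  have hsub := (hint 0 T le_rfl hT.le).sub hsh
  rw [← ofReal_integral_eq_lintegral_ofReal]
  · congr 1
    rw [← intervalIntegral.integral_of_le hT.le,
      intervalIntegral.integral_sub (hint 0 T le_rfl hT.le) hsh,
      intervalIntegral.integral_comp_add_right, zero_add,
      intervalIntegral.integral_interval_sub_interval_comm (hint _ _ le_rfl hT.le)
        (hint _ _ hs.le (by linarith)) (hint _ _ le_rfl hs.le)]
  · exact (intervalIntegrable_iff_integrableOn_Ioc_of_le hT.le).mp hsub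
  · filter_upwards [ae_restrict_mem measurableSet_Ioc] with t ht
    have := hG (mem_Ici.mpr ht.1.le) (mem_Ici.mpr (by linarith [ht.1])) (show t ≤ t + s by linarith)
    simp only [Pi.zero_apply]
    linarith

/-- In the telescoped form the window at `T` is nonnegative and is dropped, while on the window at 0
one has G ≤ G(0). -/
lemma lintegral_sub_shift_le {G : ℝ → ℝ} (hG : AntitoneOn G (Ici 0)) (h0 : ∀ t, 0 ≤ G t) {s : ℝ}
    (hs : 0 < s) :
    ∫⁻ t in Ioi 0, ENNReal.ofReal (G t - G (t + s)) ≤ ENNReal.ofReal (s * G 0) := by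
  have hU : Ioi (0 : ℝ) = ⋃ n : ℕ, Ioc (0 : ℝ) (n + 1) := by
    ext t
    simp only [mem_Ioi, mem_iUnion, mem_Ioc, exists_and_left, iff_self_and]
    intro _
    obtain ⟨n, hn⟩ := exists_nat_ge t
    exact ⟨n, by linarith⟩
  rw [hU, setLIntegral_iUnion_of_directed]
  · refine iSup_le fun n => ?_
    rw [setLIntegral_sub_shift_eq hG hs (by positivity)]
    refine ENNReal.ofReal_le_ofReal ?_
    have h1 : 0 ≤ ∫ t in ((n : ℝ) + 1)..((n : ℝ) + 1 + s), G t :=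
      intervalIntegral.integral_nonneg (by linarith) fun t _ => h0 t
    have hint : IntervalIntegrable G volume 0 s := by
      refine AntitoneOn.intervalIntegrable (hG.mono ?_)
      rw [uIcc_of_le hs.le]
      exact fun x hx => hx.1
    have h2 : ∫ t in (0 : ℝ)..s, G t ≤ ∫ _ in (0 : ℝ)..s, G 0 :=
      intervalIntegral.integral_mono_on hs.le hint intervalIntegrable_const
        fun t ht => hG (mem_Ici.mpr le_rfl) (mem_Ici.mpr ht.1) ht.1
    simp only [intervalIntegral.integral_const, sub_zero, smul_eq_mul] at h2
    linarith
  · refine directed_of_isDirected_le fun m n hmn => Ioc_subset_Ioc_right ?_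
    have : (m : ℝ) ≤ n := by exact_mod_cast hmn
    linarith

/-- Here G ≥ G(s) on the window at 0, and the window at `T` contributes at most s G(T) → 0. -/
lemma le_lintegral_sub_shift {G : ℝ → ℝ} (hG : AntitoneOn G (Ici 0))
    (hlim : Tendsto G atTop (𝓝 0)) {s : ℝ} (hs : 0 < s) :
    ENNReal.ofReal (s * G s) ≤ ∫⁻ t in Ioi 0, ENNReal.ofReal (G t - G (t + s)) := by
  have key : ∀ T, 0 < T → ENNReal.ofReal (s * (G s - G T)) ≤
      ∫⁻ t in Ioi 0, ENNReal.ofReal (G t - G (t + s)) := by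
    intro T hT
    refine le_trans ?_ (lintegral_mono_set (Ioc_subset_Ioi_self (a := T) (b := (0 : ℝ))))
    rw [setLIntegral_sub_shift_eq hG hs hT]
    refine ENNReal.ofReal_le_ofReal ?_
    have hint : ∀ a, 0 ≤ a → IntervalIntegrable G volume a (a + s) := by
      intro a ha
      refine AntitoneOn.intervalIntegrable (hG.mono ?_)
      rw [uIcc_of_le (by linarith)]
      exact fun x hx => ha.trans hx.1
    have h1 : ∫ _ in (0 : ℝ)..s, G s ≤ ∫ t in (0 : ℝ)..s, G t :=
      intervalIntegral.integral_mono_on hs.le intervalIntegrable_const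
        (by simpa using hint 0 le_rfl)
        fun t ht => hG (mem_Ici.mpr ht.1) (mem_Ici.mpr hs.le) ht.2
    have h2 : ∫ t in T..(T + s), G t ≤ ∫ _ in T..(T + s), G T :=
      intervalIntegral.integral_mono_on (by linarith) (hint T hT.le) intervalIntegrable_const
        fun t ht => hG (mem_Ici.mpr hT.le) (mem_Ici.mpr (hT.le.trans ht.1)) ht.1
    simp only [intervalIntegral.integral_const, sub_zero, smul_eq_mul, add_sub_cancel_left]
      at h1 h2
    linarith
  have hl : Tendsto (fun T => ENNReal.ofReal (s * (G s - G T))) atTop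
      (𝓝 (ENNReal.ofReal (s * (G s - 0)))) :=
    ENNReal.tendsto_ofReal ((tendsto_const_nhds.sub hlim).const_mul s)
  rw [sub_zero] at hl
  refine le_of_tendsto hl ?_
  filter_upwards [eventually_gt_atTop 0] with T hT using key T hT

lemma exists_pos_seq_tendsto_zero :
    ∃ s : ℕ → ℝ, (∀ n, 0 < s n) ∧ Tendsto s atTop (𝓝[>] 0) :=
  ⟨fun n => 1 / ((n : ℝ) + 1), fun _ => Nat.one_div_pos_of_nat,
    tendsto_nhdsWithin_iff.mpr ⟨tendsto_one_div_add_atTop_nhds_zero_nat,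
      Eventually.of_forall fun _ => mem_Ioi.mpr Nat.one_div_pos_of_nat⟩⟩

variable {d : ℕ}

/-- The reference measure on `(0, ∞) × ℝ^d × ℝ^d`. -/
noncomputable abbrev timeSpace (d : ℕ) : Measure (ℝ × Rd d × Rd d) :=
  (volume.restrict (Ioi (0 : ℝ))).prod (volume.prod volume)

lemma IsHeatKernel.ae_timeSpace {ν : Rd d → ℝ} {k : ℝ → Rd d → ℝ} (h : IsHeatKernel ν k) :
    ∀ᵐ q ∂(timeSpace d), 0 < q.1 ∧ q.2.1 - q.2.2 ≠ 0 := by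
  refine Filter.Eventually.and ?_ ?_
  · exact Measure.quasiMeasurePreserving_fst.ae (ae_restrict_mem measurableSet_Ioi)
  · have h1 : ∀ᵐ r : Rd d × Rd d ∂(volume.prod volume), r.1 - r.2 ≠ 0 := by
      have hm : MeasurableSet {r : Rd d × Rd d | r.1 - r.2 = 0} :=
        measurableSet_eq_fun (by fun_prop) (by fun_prop)
      have h2 : (volume.prod volume) {r : Rd d × Rd d | r.1 - r.2 = 0} = 0 := by
        rw [Measure.measure_prod_null hm]
        refine Eventually.of_forall fun x => ?_
        have := h.ae_ne x
        rw [ae_iff] at this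
        simp only [not_not] at this
        refine measure_mono_null (fun y hy => ?_) this
        have hy' : x - y = 0 := hy
        exact (sub_eq_zero.mp hy').symm
      rw [ae_iff]
      simpa using h2
    exact Measure.quasiMeasurePreserving_snd.ae h1

namespace IsConvexPotential

variable {p : ℝ} {Y Y₁ Y₂ : ℝ × ℝ → ℝ} (V : IsConvexPotential p Y Y₁ Y₂)
  {ν : Rd d → ℝ} {k : ℝ → Rd d → ℝ} (h : IsHeatKernel ν k) {f g : Rd d → ℝ}

lemma _root_.HardyStein.IsHeatKernel.measurable_evolvePair (h : IsHeatKernel ν k)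
    (hf : Measurable f) (hg : Measurable g) :
    Measurable fun q : ℝ × Rd d => evolvePair k f g q.1 q.2 :=
  (h.measurable_uncurry_evolve hf).prodMk (h.measurable_uncurry_evolve hg)

include V h

lemma measurable_bregman_evolvePair (hf : Measurable f) (hg : Measurable g) (s : ℝ) :
    Measurable fun q : ℝ × Rd d × Rd d =>
      bregman Y Y₁ Y₂ (evolvePair k f g (q.1 + s) q.2.2) (evolvePair k f g q.1 q.2.1) := by
  have hm := h.measurable_evolvePair hf hg
  exact V.measurable_bregman.comp
    ((hm.comp (by fun_prop : Measurable fun q : ℝ × Rd d × Rd d => (q.1 + s, q.2.2))).prodMk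
      (hm.comp (by fun_prop : Measurable fun q : ℝ × Rd d × Rd d => (q.1, q.2.1))))

lemma lintegral_bregman_eq (hp : 1 ≤ p) {W U : Rd d → ℝ × ℝ}
    (hW : PairPowIntegrable p W) (hU : PairPowIntegrable p U) (hW0 : ∀ x, 0 ≤ (W x).1)
    (hU0 : ∀ x, 0 ≤ (U x).1) {s : ℝ} (hs : 0 < s) :
    ∫⁻ r : Rd d × Rd d, ENNReal.ofReal (bregman Y Y₁ Y₂ (W r.2) (U r.1) * k s (r.1 - r.2))
      ∂(volume.prod volume) = ENNReal.ofReal (∫ q : Rd d × Rd d,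
        bregman Y Y₁ Y₂ (W q.1) (U q.2) * k s (q.2 - q.1) ∂(volume.prod volume)) := by
  have hI := V.integrable_bregman_mul_kernel h hp hW hU hs
  rw [ofReal_integral_eq_lintegral_ofReal hI (Eventually.of_forall fun q =>
    mul_nonneg (V.bregman_nonneg (hW0 _) (hU0 _)) (h.nonneg s hs _)),
    ← lintegral_prod_swap]
  rfl

lemma measurable_bregman_mul_kernel (hf : Measurable f) (hg : Measurable g) (a s : ℝ) :
    Measurable fun q : ℝ × Rd d × Rd d =>
      ENNReal.ofReal (bregman Y Y₁ Y₂ (evolvePair k f g (q.1 + a) q.2.2)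
        (evolvePair k f g q.1 q.2.1) * (k s (q.2.1 - q.2.2) / s)) :=
  ((V.measurable_bregman_evolvePair h hf hg a).mul
    (((h.measurable_apply s).comp (by fun_prop)).div_const _)).ennreal_ofReal

omit V h in
lemma _root_.HardyStein.ofReal_mul_div {s : ℝ} (hs : 0 < s) (b r : ℝ) :
    ENNReal.ofReal (b * (r / s)) = ENNReal.ofReal (1 / s) * ENNReal.ofReal (b * r) := by
  rw [← ENNReal.ofReal_mul (one_div_pos.mpr hs).le]
  congr 1; ring

omit V h in
lemma _root_.HardyStein.ofReal_one_div_mul {s : ℝ} (hs : 0 < s) (b : ℝ) :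
    ENNReal.ofReal (1 / s) * ENNReal.ofReal (s * b) = ENNReal.ofReal b := by
  rw [← ENNReal.ofReal_mul (one_div_pos.mpr hs).le, ← mul_assoc, one_div_mul_cancel hs.ne',
    one_mul]

lemma lintegral_bregman_shift_le (hp : 1 ≤ p) (hf : PowIntegrable p f) (hg : PowIntegrable p g)
    (hf0 : ∀ x, 0 ≤ f x) {s : ℝ} (hs : 0 < s) :
    ∫⁻ q, ENNReal.ofReal (bregman Y Y₁ Y₂ (evolvePair k f g (q.1 + s) q.2.2)
        (evolvePair k f g q.1 q.2.1) * (k s (q.2.1 - q.2.2) / s)) ∂(timeSpace d)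
      ≤ ENNReal.ofReal (∫ x, Y (evolvePair k f g 0 x)) := by
  have hu0 : ∀ t x, 0 ≤ (evolvePair k f g t x).1 := fun t x => h.evolve_nonneg hf0 t x
  have hupair : ∀ t, PairPowIntegrable p (evolvePair k f g t) :=
    h.pairPowIntegrable_evolvePair hp hf hg
  rw [lintegral_prod _
    (V.measurable_bregman_mul_kernel h hf.measurable hg.measurable s s).aemeasurable,
    ← ofReal_one_div_mul hs]
  refine le_trans (le_of_eq ?_) (mul_le_mul_right (lintegral_sub_shift_le
    (V.antitoneOn_integral h hp hf hg hf0) (V.integral_comp_nonneg h hf0) hs) _)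
  rw [← lintegral_const_mul' _ _ ENNReal.ofReal_ne_top]
  refine setLIntegral_congr_fun measurableSet_Ioi fun t ht => ?_
  simp only [ofReal_mul_div hs]
  rw [lintegral_const_mul' _ _ ENNReal.ofReal_ne_top, V.lintegral_bregman_eq h hp (hupair _)
    (hupair _) (hu0 _) (hu0 _) hs, V.integral_bregman_shift h hp hf hg (le_of_lt ht) hs]

lemma le_lintegral_bregman_diag (hp : 1 < p) (hf : PowIntegrable p f) (hg : PowIntegrable p g)
    (hf0 : ∀ x, 0 ≤ f x) {s : ℝ} (hs : 0 < s) :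
    ENNReal.ofReal (∫ x, Y (evolvePair k f g s x)) ≤
    ∫⁻ q, ENNReal.ofReal (bregman Y Y₁ Y₂ (evolvePair k f g q.1 q.2.2)
        (evolvePair k f g q.1 q.2.1) * (k s (q.2.1 - q.2.2) / s)) ∂(timeSpace d) := by
  have hu0 : ∀ t x, 0 ≤ (evolvePair k f g t x).1 := fun t x => h.evolve_nonneg hf0 t x
  have hupair : ∀ t, PairPowIntegrable p (evolvePair k f g t) :=
    h.pairPowIntegrable_evolvePair hp.le hf hg
  have hm := V.measurable_bregman_mul_kernel h hf.measurable hg.measurable 0 s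
  simp only [add_zero] at hm
  rw [lintegral_prod _ hm.aemeasurable, ← ofReal_one_div_mul hs]
  refine (mul_le_mul_right (le_lintegral_sub_shift
    (V.antitoneOn_integral h hp.le hf hg hf0) (V.tendsto_integral_atTop h hp hf hg hf0) hs)
    _).trans ?_
  rw [← lintegral_const_mul' _ _ ENNReal.ofReal_ne_top]
  refine setLIntegral_mono' measurableSet_Ioi fun t ht => ?_
  simp only [ofReal_mul_div hs]
  rw [lintegral_const_mul' _ _ ENNReal.ofReal_ne_top, V.lintegral_bregman_eq h hp.le (hupair _)
    (hupair _) (hu0 _) (hu0 _) hs]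
  gcongr
  exact V.sub_le_integral_bregman h hp.le hf hg hf0 (le_of_lt ht) hs

omit V in
lemma _root_.HardyStein.IsHeatKernel.continuousAt_evolvePair (hp : 1 ≤ p) (hf : PowIntegrable p f)
    (hg : PowIntegrable p g) {t : ℝ} (ht : 0 < t) (x : Rd d) :
    ContinuousAt (fun r => evolvePair k f g r x) t :=
  (h.continuousAt_evolve hp hf ht x).prodMk (h.continuousAt_evolve hp hg ht x)

lemma tendsto_bregman_shift (hp : 1 ≤ p) (hf : PowIntegrable p f) (hg : PowIntegrable p g)
    {s : ℕ → ℝ} (hs : Tendsto s atTop (𝓝 0)) {t : ℝ} (ht : 0 < t) (x y : Rd d) :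
    Tendsto (fun n => bregman Y Y₁ Y₂ (evolvePair k f g (t + s n) x) (evolvePair k f g t y)) atTop
      (𝓝 (bregman Y Y₁ Y₂ (evolvePair k f g t x) (evolvePair k f g t y))) := by
  have hadd : Tendsto (fun n => t + s n) atTop (𝓝 t) := by simpa using hs.const_add t
  have h1 : Tendsto (fun n => evolvePair k f g (t + s n) x) atTop (𝓝 (evolvePair k f g t x)) :=
    (h.continuousAt_evolvePair hp hf hg ht x).tendsto.comp hadd
  have h2 : Continuous fun w => bregman Y Y₁ Y₂ w (evolvePair k f g t y) :=
    V.continuous_bregman.comp (continuous_id.prodMk continuous_const)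
  exact (h2.tendsto _).comp h1

/-- Fatou's lemma along a sequence of shifts tending to 0; no majorant is known yet, and the shifted
integrals are bounded uniformly by the exact telescoping. -/
lemma lintegral_bregman_mul_jump_le (hp : 1 ≤ p) (hf : PowIntegrable p f)
    (hg : PowIntegrable p g) (hf0 : ∀ x, 0 ≤ f x) :
    ∫⁻ q, ENNReal.ofReal (bregman Y Y₁ Y₂ (evolvePair k f g q.1 q.2.2)
      (evolvePair k f g q.1 q.2.1) * ν (q.2.1 - q.2.2)) ∂(timeSpace d)
      ≤ ENNReal.ofReal (∫ x, Y (evolvePair k f g 0 x)) := by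
  obtain ⟨s, hspos, hsw⟩ := exists_pos_seq_tendsto_zero
  have hs0 : Tendsto s atTop (𝓝 0) := hsw.mono_right nhdsWithin_le_nhds
  have hlim : ∀ᵐ q ∂(timeSpace d), ENNReal.ofReal (bregman Y Y₁ Y₂ (evolvePair k f g q.1 q.2.2)
      (evolvePair k f g q.1 q.2.1) * ν (q.2.1 - q.2.2)) = liminf (fun n => ENNReal.ofReal
      (bregman Y Y₁ Y₂ (evolvePair k f g (q.1 + s n) q.2.2) (evolvePair k f g q.1 q.2.1) *
        (k (s n) (q.2.1 - q.2.2) / s n))) atTop := by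
    filter_upwards [h.ae_timeSpace] with q hq
    refine (Tendsto.liminf_eq ?_).symm
    exact ENNReal.tendsto_ofReal ((V.tendsto_bregman_shift h hp hf hg hs0 hq.1 _ _).mul
      ((h.small_time _ hq.2).comp hsw))
  rw [lintegral_congr_ae hlim]
  refine (lintegral_liminf_le fun n =>
    V.measurable_bregman_mul_kernel h hf.measurable hg.measurable (s n) (s n)).trans ?_
  refine liminf_le_of_le (by isBoundedDefault) fun b hb => ?_
  obtain ⟨n, hn⟩ := hb.exists
  exact hn.trans (V.lintegral_bregman_shift_le h hp hf hg hf0 (hspos n))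

/-- The Hardy–Stein identity for a convex potential. -/
theorem lintegral_bregman_mul_jump (hp : 1 < p) (hf : PowIntegrable p f) (hg : PowIntegrable p g)
    (hf0 : ∀ x, 0 ≤ f x) :
    ∫⁻ q, ENNReal.ofReal (bregman Y Y₁ Y₂ (evolvePair k f g q.1 q.2.2)
      (evolvePair k f g q.1 q.2.1) * ν (q.2.1 - q.2.2)) ∂(timeSpace d)
      = ENNReal.ofReal (∫ x, Y (evolvePair k f g 0 x)) := by
  have hu0 : ∀ t x, 0 ≤ (evolvePair k f g t x).1 := fun t x => h.evolve_nonneg hf0 t x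
  obtain ⟨s, hspos, hsw⟩ := exists_pos_seq_tendsto_zero
  obtain ⟨c, hc0, hc⟩ := h.relative_bound
  have hupper := V.lintegral_bregman_mul_jump_le h hp.le hf hg hf0
  refine le_antisymm hupper ?_
  have hdct : Tendsto (fun n => ∫⁻ q, ENNReal.ofReal (bregman Y Y₁ Y₂
      (evolvePair k f g q.1 q.2.2) (evolvePair k f g q.1 q.2.1) *
      (k (s n) (q.2.1 - q.2.2) / s n)) ∂(timeSpace d)) atTop
      (𝓝 (∫⁻ q, ENNReal.ofReal (bregman Y Y₁ Y₂ (evolvePair k f g q.1 q.2.2)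
        (evolvePair k f g q.1 q.2.1) * ν (q.2.1 - q.2.2)) ∂(timeSpace d))) := by
    -- The majorant is c times the limit integrand itself, of finite integral by `hupper`.
    refine tendsto_lintegral_of_dominated_convergence (fun q => ENNReal.ofReal c *
      ENNReal.ofReal (bregman Y Y₁ Y₂ (evolvePair k f g q.1 q.2.2)
        (evolvePair k f g q.1 q.2.1) * ν (q.2.1 - q.2.2))) (fun n => ?_) (fun n => ?_) ?_ ?_
    · have hm := V.measurable_bregman_mul_kernel h hf.measurable hg.measurable 0 (s n)
      simpa only [add_zero] using hm
    · filter_upwards [h.ae_timeSpace] with q hq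
      rw [← ENNReal.ofReal_mul hc0]
      refine ENNReal.ofReal_le_ofReal ?_
      have hb := V.bregman_nonneg (hu0 q.1 q.2.2) (hu0 q.1 q.2.1)
      have h1 : k (s n) (q.2.1 - q.2.2) / s n ≤ c * ν (q.2.1 - q.2.2) := by
        rw [div_le_iff₀ (hspos n)]
        linarith [hc (s n) (hspos n) _ hq.2]
      linarith [mul_le_mul_of_nonneg_left h1 hb]
    · rw [lintegral_const_mul' _ _ ENNReal.ofReal_ne_top]
      exact ENNReal.mul_ne_top ENNReal.ofReal_ne_top (hupper.trans_lt ENNReal.ofReal_lt_top).ne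
    · filter_upwards [h.ae_timeSpace] with q hq
      exact ENNReal.tendsto_ofReal (((h.small_time _ hq.2).comp hsw).const_mul _)
  exact le_of_tendsto_of_tendsto' (ENNReal.tendsto_ofReal
    ((V.tendsto_integral_zero h hp.le hf hg hf0).comp hsw)) hdct fun n =>
    V.le_lintegral_bregman_diag h hp hf hg hf0 (hspos n)

/-- The Hardy–Stein identity for a convex potential, with Bochner integrals. -/
theorem integrable_bregman_mul_jump (hp : 1 < p) (hf : PowIntegrable p f) (hg : PowIntegrable p g)
    (hf0 : ∀ x, 0 ≤ f x) :
    Integrable (fun q : ℝ × Rd d × Rd d => bregman Y Y₁ Y₂ (evolvePair k f g q.1 q.2.2)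
      (evolvePair k f g q.1 q.2.1) * ν (q.2.1 - q.2.2)) (timeSpace d) ∧
    ∫ q, bregman Y Y₁ Y₂ (evolvePair k f g q.1 q.2.2)
      (evolvePair k f g q.1 q.2.1) * ν (q.2.1 - q.2.2) ∂(timeSpace d) = ∫ x, Y (f x, g x) := by
  have hL := V.lintegral_bregman_mul_jump h hp hf hg hf0
  have h0 : evolvePair k f g 0 = fun x => (f x, g x) := by
    ext x <;> simp [evolvePair, evolve_zero]
  rw [h0] at hL
  have hm : AEStronglyMeasurable (fun q : ℝ × Rd d × Rd d => bregman Y Y₁ Y₂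
      (evolvePair k f g q.1 q.2.2) (evolvePair k f g q.1 q.2.1) * ν (q.2.1 - q.2.2))
      (timeSpace d) := by
    have h1 := V.measurable_bregman_evolvePair h hf.measurable hg.measurable 0
    simp only [add_zero] at h1
    exact (h1.mul (h.levy.measurable.comp (by fun_prop))).aestronglyMeasurable
  have hnn : 0 ≤ᵐ[timeSpace d] fun q : ℝ × Rd d × Rd d => bregman Y Y₁ Y₂
      (evolvePair k f g q.1 q.2.2) (evolvePair k f g q.1 q.2.1) * ν (q.2.1 - q.2.2) := by
    filter_upwards [h.ae_timeSpace] with q hq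
    exact mul_nonneg (V.bregman_nonneg (h.evolve_nonneg hf0 _ _) (h.evolve_nonneg hf0 _ _))
      (h.levy.pos _ hq.2).le
  constructor
  · refine ⟨hm, ?_⟩
    rw [hasFiniteIntegral_iff_ofReal hnn, hL]
    exact ENNReal.ofReal_lt_top
  · rw [integral_eq_lintegral_of_nonneg_ae hnn hm, hL, ENNReal.toReal_ofReal]
    exact integral_nonneg fun x => V.nonneg _ (hf0 x)

end IsConvexPotential

end HardyStein

/-! ### From convex potentials to the co-divergence -/

namespace HardyStein

variable {d : ℕ}

lemma evolve_congr_ae {k : ℝ → Rd d → ℝ} {f g : Rd d → ℝ} (hfg : f =ᵐ[volume] g) {t : ℝ}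
    (ht : 0 < t) (x : Rd d) : evolve k t f x = evolve k t g x := by
  rw [evolve_of_pos ht, evolve_of_pos ht]
  refine integral_congr_ae ?_
  filter_upwards [hfg] with y hy
  rw [hy]

/-- Linearity in the first components reduces signed `f` to its positive and negative parts. -/
lemma bregmanCoDivergence_sub_fst (p a a' b c c' e : ℝ) :
    bregmanCoDivergence p (a - a', b) (c - c', e) =
      bregmanCoDivergence p (a, b) (c, e) - bregmanCoDivergence p (a', b) (c', e) := by
  unfold bregmanCoDivergence
  ring

/-- The polarized identity for a nonnegative first component. -/
lemma IsHeatKernel.integrable_coDivergence_of_nonneg {ν : Rd d → ℝ} {k : ℝ → Rd d → ℝ}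
    (h : IsHeatKernel ν k) {p : ℝ} (hp : 2 ≤ p) {f g : Rd d → ℝ} (hf : PowIntegrable p f)
    (hg : PowIntegrable p g) (hf0 : ∀ x, 0 ≤ f x) :
    Integrable (fun q : ℝ × Rd d × Rd d => bregmanCoDivergence p (evolvePair k f g q.1 q.2.2)
      (evolvePair k f g q.1 q.2.1) * ν (q.2.1 - q.2.2)) (timeSpace d) ∧
    Integrable (fun x => f x * signedPow (g x) (p - 1)) ∧
    ∫ q, bregmanCoDivergence p (evolvePair k f g q.1 q.2.2)
      (evolvePair k f g q.1 q.2.1) * ν (q.2.1 - q.2.2) ∂(timeSpace d)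
      = ∫ x, f x * signedPow (g x) (p - 1) := by
  obtain ⟨κ, κ', μ, μ', hκ, hμ, e, e'⟩ := exists_isConvexPower_sub hp
  have V := hκ.isConvexPotential hp
  have W := hμ.isConvexPotential hp
  obtain ⟨i1, j1⟩ := V.integrable_bregman_mul_jump h (by linarith) hf hg hf0
  obtain ⟨i2, j2⟩ := W.integrable_bregman_mul_jump h (by linarith) hf hg hf0
  have hU : PairPowIntegrable p fun x => (f x, g x) := ⟨hf, hg⟩
  have hV := V.integrable_comp hU
  have hW := W.integrable_comp hU
  have eY : ∀ x, f x * signedPow (g x) (p - 1) =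
      potential p κ (f x, g x) - potential p μ (f x, g x) := by
    intro x
    rw [e]
    unfold potential
    ring
  simp_rw [bregmanCoDivergence_eq_sub e e', sub_mul, eY]
  refine ⟨i1.sub i2, hV.sub hW, ?_⟩
  rw [integral_sub i1 i2, integral_sub hV hW, j1, j2]

/-- The polarized identity for the semigroup of a heat kernel. -/
lemma IsHeatKernel.integrable_coDivergence {ν : Rd d → ℝ} {k : ℝ → Rd d → ℝ}
    (h : IsHeatKernel ν k) {p : ℝ} (hp : 2 ≤ p) {f g : Rd d → ℝ} (hf : PowIntegrable p f)
    (hg : PowIntegrable p g) :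
    Integrable (fun q : ℝ × Rd d × Rd d => bregmanCoDivergence p (evolvePair k f g q.1 q.2.2)
      (evolvePair k f g q.1 q.2.1) * ν (q.2.1 - q.2.2)) (timeSpace d) ∧
    Integrable (fun x => f x * signedPow (g x) (p - 1)) ∧
    ∫ q, bregmanCoDivergence p (evolvePair k f g q.1 q.2.2)
      (evolvePair k f g q.1 q.2.1) * ν (q.2.1 - q.2.2) ∂(timeSpace d)
      = ∫ x, f x * signedPow (g x) (p - 1) := by
  have hp0 : 0 ≤ p := by linarith
  have hf1 := hf.posPart hp0
  have hf2 := hf.neg.posPart hp0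
  obtain ⟨i1, j1, k1⟩ := h.integrable_coDivergence_of_nonneg hp hf1 hg fun x => le_max_right _ _
  obtain ⟨i2, j2, k2⟩ := h.integrable_coDivergence_of_nonneg hp hf2 hg fun x => le_max_right _ _
  have ef : f = fun x => max (f x) 0 - max (-f x) 0 := by
    ext x
    exact (max_zero_sub_max_neg_zero_eq_self (f x)).symm
  have eu : ∀ t x, evolvePair k f g t x =
      (evolve k t (fun y => max (f y) 0) x - evolve k t (fun y => max (-f y) 0) x,
        evolve k t g x) := by
    intro t x
    rw [← h.evolve_sub (by linarith) hf1 hf2, ← ef]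
    rfl
  have eφ : ∀ x, f x * signedPow (g x) (p - 1) = max (f x) 0 * signedPow (g x) (p - 1) -
      max (-f x) 0 * signedPow (g x) (p - 1) := by
    intro x
    rw [← sub_mul, ← congrFun ef x]
  simp_rw [eu, bregmanCoDivergence_sub_fst, sub_mul, eφ]
  refine ⟨i1.sub i2, j1.sub j2, ?_⟩
  rw [integral_sub j1 j2, ← k1, ← k2]
  exact integral_sub i1 i2

end HardyStein

theorem theorem4p1 (d : ℕ) (hd : 1 ≤ d) (ν : HardyStein.Rd d → ℝ)
    (hν : HardyStein.IsLevyDensity ν) (hHW : HardyStein.HartmanWintner ν)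
    (hP1 : HardyStein.RelativeUpperBound ν) (hP2 : HardyStein.SmallTimeLimit ν)
    (p : ℝ) (hp : 2 ≤ p) (f g : HardyStein.Rd d → ℝ)
    (hf : MemLp f (ENNReal.ofReal p) volume) (hg : MemLp g (ENNReal.ofReal p) volume)
    (Φ : HardyStein.Rd d → ℝ × ℝ) (hΦ : ∀ x, Φ x = (f x, g x)) :
    -- the triple integral converges absolutely (as an iterated integral, and jointly in `(t, y, x)`)
    (∫⁻ t in Ioi (0 : ℝ), ∫⁻ y, ∫⁻ x, ENNReal.ofReal
        (|HardyStein.bregmanCoDivergence p (HardyStein.semigroupPair ν t Φ x)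
            (HardyStein.semigroupPair ν t Φ y)| * HardyStein.jumpKernel ν x y)) < ⊤ ∧
    Integrable
      (fun q : ℝ × HardyStein.Rd d × HardyStein.Rd d =>
        HardyStein.bregmanCoDivergence p (HardyStein.semigroupPair ν q.1 Φ q.2.2)
          (HardyStein.semigroupPair ν q.1 Φ q.2.1) * HardyStein.jumpKernel ν q.2.2 q.2.1)
      ((volume.restrict (Ioi (0 : ℝ))).prod (volume.prod volume)) ∧
    -- the polarized Hardy–Stein identity, whose left-hand side converges absolutely
    Integrable (fun x => f x * HardyStein.signedPow (g x) (p - 1)) ∧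
    ∫ x, f x * HardyStein.signedPow (g x) (p - 1) =
      ∫ t in Ioi (0 : ℝ), ∫ y, ∫ x,
        HardyStein.bregmanCoDivergence p (HardyStein.semigroupPair ν t Φ x)
          (HardyStein.semigroupPair ν t Φ y) * HardyStein.jumpKernel ν x y := by
  have h := HardyStein.isHeatKernel_heatDensity hd hν hHW hP1 hP2
  have hp0 : 0 < p := by linarith
  -- Borel representatives; for t > 0 the semigroup does not see the change, and t = 0 is outside
  -- the domain of integration.
  obtain ⟨f', hf'm, hff'⟩ := hf.aestronglyMeasurable.aemeasurable
  obtain ⟨g', hg'm, hgg'⟩ := hg.aestronglyMeasurable.aemeasurable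
  have hf' := HardyStein.PowIntegrable.of_memLp hp0 hf'm ((memLp_congr_ae hff').mp hf)
  have hg' := HardyStein.PowIntegrable.of_memLp hp0 hg'm ((memLp_congr_ae hgg').mp hg)
  obtain ⟨hI, hφ, hJ⟩ := h.integrable_coDivergence hp hf' hg'
  obtain rfl : Φ = fun x => (f x, g x) := funext hΦ
  have eu : ∀ t, 0 < t → ∀ x, HardyStein.semigroupPair ν t (fun x => (f x, g x)) x =
      HardyStein.evolvePair (HardyStein.heatDensity ν) f' g' t x := fun t ht x =>
    Prod.ext (HardyStein.evolve_congr_ae hff' ht x) (HardyStein.evolve_congr_ae hgg' ht x)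
  have eφ : (fun x => f x * HardyStein.signedPow (g x) (p - 1)) =ᵐ[volume]
      fun x => f' x * HardyStein.signedPow (g' x) (p - 1) := by
    filter_upwards [hff', hgg'] with x h1 h2
    rw [h1, h2]
  have eJ : (fun q : ℝ × HardyStein.Rd d × HardyStein.Rd d =>
        HardyStein.bregmanCoDivergence p
          (HardyStein.evolvePair (HardyStein.heatDensity ν) f' g' q.1 q.2.2)
          (HardyStein.evolvePair (HardyStein.heatDensity ν) f' g' q.1 q.2.1) *
          ν (q.2.1 - q.2.2)) =ᵐ[HardyStein.timeSpace d]
      fun q => HardyStein.bregmanCoDivergence p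
          (HardyStein.semigroupPair ν q.1 (fun x => (f x, g x)) q.2.2)
          (HardyStein.semigroupPair ν q.1 (fun x => (f x, g x)) q.2.1) *
          HardyStein.jumpKernel ν q.2.2 q.2.1 := by
    filter_upwards [h.ae_timeSpace] with q hq
    rw [eu _ hq.1, eu _ hq.1]
    rfl
  have hI' := hI.congr eJ
  refine ⟨?_, hI', hφ.congr eφ.symm, ?_⟩
  · have hfin := hI'.hasFiniteIntegral
    rw [hasFiniteIntegral_iff_norm, lintegral_prod _ hI'.norm.aemeasurable.ennreal_ofReal] at hfin
    refine lt_of_le_of_lt (lintegral_mono_ae ?_) hfin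
    filter_upwards [hI'.prod_right_ae] with t ht
    rw [lintegral_prod _ ht.norm.aemeasurable.ennreal_ofReal]
    -- Only an inequality: on the diagonal the kernel takes the value `ν 0`, whose sign is unknown.
    refine lintegral_mono fun y => lintegral_mono fun x => ENNReal.ofReal_le_ofReal ?_
    rw [norm_mul, Real.norm_eq_abs, Real.norm_eq_abs]
    exact mul_le_mul_of_nonneg_left (le_abs_self _) (abs_nonneg _)
  · rw [integral_congr_ae eφ, ← hJ, integral_congr_ae eJ, integral_prod _ hI']
    refine integral_congr_ae ?_
    filter_upwards [hI'.prod_right_ae] with t ht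
    rw [integral_prod _ ht]
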